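/- Let $X=\{x_k\}_{k\in\mathbb Z}\subset\mathbb R$ be a strictly increasing sequence that is separated, i.e. $\inf_k|x_{k+1}-x_k|>0$. Suppose that $X$ has a sine-type generating function $S$ of exponential type $\pi b$. This means: the limit $$S(z)=z^{\delta_X}\lim_{r\to\infty}\prod_{0<|x_k|<r}\Big(1-\frac{z}{x_k}\Big)$$ exists for every $z\in\mathbb C$, where $\delta_X=1$ if $0\in X$ and $\delta_X=0$ otherwise; $S$ is entire of exponential type $\pi b<\infty$; and for every $\epsilon>0$ there are constants $C_1(\epsilon),C_2(\epsilon)>0$ with $C_1(\epsilon)\le e^{-\pi b|\mathrm{Im}\,z|}|S(z)|\le C_2(\epsilon)$ whenever $\mathrm{dist}(z,X)>\epsilon$. Let $\tilde x\in\mathbb C\setminus X$, and let $$PW_b^+=\Big\{f\ \text{entire}:\ \limsup_{r\to\infty}\int_{|z|=r}\big|z^{-2}e^{-\pi b|\mathrm{Im}\,z|}f(z)\big|\,|dz|=0\Big\}.$$ (i) If $f\in PW_b^+$, $a_k=f(x_k)$ and $\tilde a=f(\tilde x)$, then $$f(z)=\tilde a\,\frac{S(z)}{S(\tilde x)}+\sum_{k=-\infty}^{\infty}a_k\lim_{z_0\to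 z}\frac{S(z_0)}{S'(x_k)}\Big(\frac1{z_0-x_k}-\frac1{\tilde x-x_k}\Big),\qquad z\in\mathbb C,\qquad(\ast)$$ where the sum is the limit as $r\to\infty$ of the sums over $|x_k|<r$, and the convergence is uniform on compact subsets of $\mathbb C$. (ii) Conversely, for every $\tilde a\in\mathbb C$ and every bounded sequence $A=\{a_k\}_{k\in\mathbb Z}$ of complex numbers, the series $(\ast)$ converges uniformly on compact subsets of $\mathbb C$ (irrespective of the order of summation), and its sum $f$ lies in $PW_b^+$ and satisfies $f(x_k)=a_k$ for all $k$, $f(\tilde x)=\tilde a$, and $$|f(z)|\le C\,\max(\|A\|_{\ell^\infty},|\tilde a|)\,e^{\pi b|\mathrm{Im}\,z|}\,\big(1+\max(\log|z|,0)\big),\qquad z\in\mathbb C,$$ with a constant $C$ that does not depend on $A$ and $\tilde a$. -/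

import Mathlib

open Filter Topology

/-- The separation constant `λ(X) = inf_k |x_{k+1} - x_k|` of a sequence of real points. -/
noncomputable def separationConstant (x : ℤ → ℝ) : ℝ :=
  ⨅ k : ℤ, |x (k + 1) - x k|

/-- An increasing bi-infinite sequence of real points with positive separation constant. -/
structure IsSeparatedSeq (x : ℤ → ℝ) : Prop where
  strictMono : StrictMono x
  separationConstant_pos : 0 < separationConstant x

/-- `X`, viewed as a subset of the complex plane. -/
def pointSet (x : ℤ → ℝ) : Set ℂ :=
  Set.range fun k : ℤ => (x k : ℂ)

open Classical in
/-- The partial product `z^δ ∏_{0 < |x_k| < r} (1 - z / x_k)`, where `δ = 1` if `0 ∈ X` and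
`δ = 0` otherwise. For a separated sequence only finitely many `k` occur. -/
noncomputable def genPartialProd (x : ℤ → ℝ) (r : ℝ) (z : ℂ) : ℂ :=
  z ^ (if ∃ k, x k = 0 then 1 else 0 : ℕ) *
    ∏ᶠ k ∈ {k : ℤ | 0 < |x k| ∧ |x k| < r}, (1 - z / (x k : ℂ))

/-- The product converges, and `S` is the generating function of `X`. -/
def IsGeneratingFunction (x : ℤ → ℝ) (S : ℂ → ℂ) : Prop :=
  ∀ z : ℂ, Tendsto (fun r : ℝ => genPartialProd x r z) atTop (𝓝 (S z))

/-- `f` is entire of (finite) exponential type equal to `σ`. -/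
def HasExponentialType (f : ℂ → ℂ) (σ : ℝ) : Prop :=
  Differentiable ℂ f ∧
    IsGLB {β : ℝ | ∃ C : ℝ, ∀ z : ℂ, ‖f z‖ ≤ C * Real.exp (β * ‖z‖)} σ

/-- `S` is the generating function of `X`, it is sine-type, and its type is `π b`. -/
structure IsSineTypeGenerating (x : ℤ → ℝ) (S : ℂ → ℂ) (b : ℝ) : Prop where
  generating : IsGeneratingFunction x S
  type_eq : HasExponentialType S (Real.pi * b)
  bounds : ∀ ε : ℝ, 0 < ε → ∃ C₁ C₂ : ℝ, 0 < C₁ ∧ 0 < C₂ ∧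
    ∀ z : ℂ, ε < Metric.infDist z (pointSet x) →
      C₁ ≤ Real.exp (-(Real.pi * b * |z.im|)) * ‖S z‖ ∧
      Real.exp (-(Real.pi * b * |z.im|)) * ‖S z‖ ≤ C₂

/-- The arc-length integral `∫_{|z| = r} |z^{-2} e^{-π b |Im z|} f(z)| |dz|`, for `r > 0`. -/
noncomputable def circleGrowth (b : ℝ) (f : ℂ → ℂ) (r : ℝ) : ℝ :=
  ∫ θ in (0 : ℝ)..(2 * Real.pi),
    (‖circleMap 0 r θ‖ ^ 2)⁻¹ * Real.exp (-(Real.pi * b * |(circleMap 0 r θ).im|)) *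
      ‖f (circleMap 0 r θ)‖ * r

/-- The space `PW_b^+` of the entire functions whose weighted circle integrals tend to `0`. -/
def PWPlus (b : ℝ) : Set (ℂ → ℂ) :=
  {f | Differentiable ℂ f ∧ Tendsto (circleGrowth b f) atTop (𝓝 0)}

/-- `lim_{z₀ → z} S(z₀) / S'(x_k) * (1 / (z₀ - x_k) - 1 / (x̃ - x_k))`. The limit only matters
at `z = x_k`, where the function of `z₀` has a removable singularity. -/
noncomputable def interpKernel (x : ℤ → ℝ) (S : ℂ → ℂ) (xt : ℂ) (k : ℤ) (z : ℂ) : ℂ :=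
  limUnder (𝓝[≠] z) fun z₀ : ℂ =>
    S z₀ / deriv S (x k : ℂ) * (1 / (z₀ - (x k : ℂ)) - 1 / (xt - (x k : ℂ)))

/-- The part of the series `ã S(z) / S(x̃) + ∑_k a_k lim_{z₀ → z} …` with the indices `k` in a
finite set `s`. -/
noncomputable def interpPartialSum (x : ℤ → ℝ) (S : ℂ → ℂ) (xt ta : ℂ) (a : ℤ → ℂ)
    (s : Set ℤ) (z : ℂ) : ℂ :=
  ta * (S z / S xt) + ∑ᶠ k ∈ s, a k * interpKernel x S xt k z

/-!
For `f ∈ PWPlus b` the residue theorem applied to `f ζ / S ζ * ((ζ - z)⁻¹ - (ζ - x̃)⁻¹)` on a circle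
`|ζ| = ρ` expresses the error of the partial sum over `|x k| < ρ` as a contour integral. If the
circle keeps a fixed distance from `X`, the lower bound for `S` there bounds this integral by a
multiple of `circleGrowth b f ρ`, which tends to `0`. Such good radii occur in every interval of
length `l / 4`, so a general `r` lies between two of them with at most two nodes in between. Their
contributions are bounded separately: weighting the contour integral with a Lagrange basis
polynomial which is `1` at one node and `0` at the other isolates a single residue.

Conversely, the `k`-th interpolation kernel has size at most a constant times
`e^(π b |Im z|) |z - x̃| / ((1 + |z - x k|) (1 + |x̃ - x k|))`. By separation, summing over `k`
compares with a harmonic sum and yields both absolute convergence and the logarithmic growth.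

Both parts use that the zeros of `S` are simple.
-/

/-! ### Separated families -/

/-- A family of real points, in no particular order, whose pairwise distances are at least a
fixed `l > 0`. -/
structure IsSeparatedBy {ι : Type*} (l : ℝ) (x : ι → ℝ) : Prop where
  pos : 0 < l
  le_abs_sub : Pairwise fun j k => l ≤ |x j - x k|

lemma sum_range_inv_sub_inv_add_le (M N : ℕ) :
    ∑ m ∈ Finset.range M, ((m + 1 : ℝ)⁻¹ - (m + 1 + N : ℝ)⁻¹) ≤
      ∑ m ∈ Finset.range N, (m + 1 : ℝ)⁻¹ := by
  have hsplit : ∑ m ∈ Finset.range (N + M), (m + 1 : ℝ)⁻¹ =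
      ∑ m ∈ Finset.range N, (m + 1 : ℝ)⁻¹ + ∑ m ∈ Finset.range M, (m + 1 + N : ℝ)⁻¹ := by
    rw [Finset.sum_range_add]
    push_cast
    simp only [add_assoc, add_comm]
  have hmono : ∑ m ∈ Finset.range M, (m + 1 : ℝ)⁻¹ ≤ ∑ m ∈ Finset.range (N + M), (m + 1 : ℝ)⁻¹ :=
    Finset.sum_le_sum_of_subset_of_nonneg (Finset.range_mono (Nat.le_add_left M N))
      fun m _ _ => by positivity
  rw [Finset.sum_sub_distrib]
  linarith

lemma sum_range_inv_le_one_add_log (N : ℕ) :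
    ∑ m ∈ Finset.range N, (m + 1 : ℝ)⁻¹ ≤ 1 + Real.log N := by
  have h := harmonic_le_one_add_log N
  simpa [harmonic] using h

lemma div_mul_add_le_div_mul_add {m t u : ℝ} (hm : 0 < m) (ht : 0 ≤ t) (htu : t ≤ u) :
    t / (m * (m + t)) ≤ u / (m * (m + u)) := by
  have hu := ht.trans htu
  rw [div_le_div_iff₀ (by positivity) (by positivity)]
  nlinarith [mul_le_mul_of_nonneg_left htu (mul_pos hm hm).le]

lemma sum_nat_div_mul_add_le {t : ℝ} (ht : 0 ≤ t) (s : Finset ℕ) :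
    ∑ n ∈ s, t / ((1 + n) * (1 + n + t)) ≤ 1 + Real.log (1 + t) := by
  obtain ⟨M, hM⟩ := s.exists_nat_subset_range
  have hterm (n : ℕ) : t / ((1 + n) * (1 + n + t)) ≤ (n + 1 : ℝ)⁻¹ - (n + 1 + ⌈t⌉₊ : ℝ)⁻¹ :=
    calc t / ((1 + n) * (1 + n + t)) ≤ ⌈t⌉₊ / ((1 + n) * (1 + n + ⌈t⌉₊)) :=
          div_mul_add_le_div_mul_add (by positivity) ht (Nat.le_ceil t)
      _ = (n + 1 : ℝ)⁻¹ - (n + 1 + ⌈t⌉₊ : ℝ)⁻¹ := by field_simp; ring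
  have hlog : Real.log ⌈t⌉₊ ≤ Real.log (1 + t) := by
    rcases Nat.eq_zero_or_pos ⌈t⌉₊ with h | h
    · simpa [h] using Real.log_nonneg (by linarith : 1 ≤ 1 + t)
    · exact Real.log_le_log (by exact_mod_cast h) (by linarith [Nat.ceil_lt_add_one ht])
  calc ∑ n ∈ s, t / ((1 + n) * (1 + n + t))
      ≤ ∑ n ∈ Finset.range M, t / ((1 + n) * (1 + n + t)) :=
        Finset.sum_le_sum_of_subset_of_nonneg hM fun n _ _ => by positivity
    _ ≤ ∑ n ∈ Finset.range M, ((n + 1 : ℝ)⁻¹ - (n + 1 + ⌈t⌉₊ : ℝ)⁻¹) :=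
        Finset.sum_le_sum fun n _ => hterm n
    _ ≤ 1 + Real.log ⌈t⌉₊ :=
        (sum_range_inv_sub_inv_add_le M _).trans (sum_range_inv_le_one_add_log _)
    _ ≤ 1 + Real.log (1 + t) := by linarith

lemma sum_int_div_mul_add_le {t : ℝ} (ht : 0 ≤ t) (s : Finset ℤ) :
    ∑ n ∈ s, t / ((1 + |(n : ℝ)|) * (1 + |(n : ℝ)| + t)) ≤ 2 * (1 + Real.log (1 + t)) := by
  have hinj {u : Finset ℤ} (hu : Set.InjOn Int.natAbs u) :
      ∑ n ∈ u, t / ((1 + |(n : ℝ)|) * (1 + |(n : ℝ)| + t)) ≤ 1 + Real.log (1 + t) := by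
    refine le_trans (le_of_eq ?_) (sum_nat_div_mul_add_le ht (u.image Int.natAbs))
    rw [Finset.sum_image hu]
    simp only [Nat.cast_natAbs, Int.cast_abs]
  rw [← Finset.sum_filter_add_sum_filter_not s (0 ≤ ·), two_mul]
  refine add_le_add (hinj fun m hm n hn h => ?_) (hinj fun m hm n hn h => ?_) <;>
  · simp only [Finset.coe_filter, Set.mem_ofPred_eq] at hm hn
    omega

lemma div_mul_le_three_mul_add {p q t : ℝ} (hp : 0 < p) (hq : 0 < q) (ht : 0 ≤ t)
    (htpq : t ≤ p + q) :
    t / (p * q) ≤ 3 * (t / (p * (p + t)) + t / (q * (q + t))) := by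
  have key {p q : ℝ} (hp : 0 < p) (hpq : p ≤ q) (htpq : t ≤ p + q) :
      t / (p * q) ≤ 3 * (t / (p * (p + t))) := by
    have hq := hp.trans_le hpq
    rw [← mul_div_assoc, div_le_div_iff₀ (by positivity) (by positivity)]
    have : 0 ≤ t * p * (2 * q - p + (q - t) + p) := by
      apply mul_nonneg (by positivity); linarith
    nlinarith
  rcases le_total p q with h | h
  · linarith [key hp h htpq, show 0 ≤ t / (q * (q + t)) by positivity]
  · have := key hq h (by linarith)
    rw [mul_comm q p] at this
    linarith [show 0 ≤ t / (p * (p + t)) by positivity]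

namespace IsSeparatedBy

variable {ι : Type*} {l : ℝ} {x : ι → ℝ} (hx : IsSeparatedBy l x)
include hx

lemma floor_injective (y : ℝ) : Function.Injective fun k => ⌊(x k - y) / l⌋ := by
  intro j k h
  by_contra hne
  have hlt := Int.abs_sub_lt_one_of_floor_eq_floor h
  rw [← sub_div, sub_sub_sub_cancel_right, abs_div, abs_of_pos hx.pos, div_lt_one hx.pos] at hlt
  exact hlt.not_ge (hx.le_abs_sub hne)

lemma one_add_abs_floor_le (y : ℝ) (k : ι) :
    1 + |(⌊(x k - y) / l⌋ : ℝ)| ≤ (2 + l⁻¹) * (1 + |y - x k|) := by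
  have hpos := hx.pos
  have hfloor : |(⌊(x k - y) / l⌋ : ℝ)| ≤ 1 + |y - x k| * l⁻¹ := by
    rw [abs_sub_comm, ← abs_of_pos (inv_pos.2 hpos), ← abs_mul, ← div_eq_mul_inv]
    have h₁ := Int.floor_le ((x k - y) / l)
    have h₂ := Int.sub_one_lt_floor ((x k - y) / l)
    rw [abs_le]
    constructor <;> linarith [neg_abs_le ((x k - y) / l), le_abs_self ((x k - y) / l)]
  nlinarith [abs_nonneg (y - x k), inv_pos.2 hpos]

lemma finite_abs_lt (r : ℝ) : {k | |x k| < r}.Finite := by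
  refine Set.Finite.of_finite_image (f := fun k => ⌊(x k - 0) / l⌋) ?_
    (hx.floor_injective 0).injOn
  refine (Set.finite_Icc ⌊-r / l⌋ ⌊r / l⌋).subset ?_
  rintro _ ⟨k, hk, rfl⟩
  obtain ⟨h₁, h₂⟩ := abs_lt.1 (show |x k| < r from hk)
  have hpos := hx.pos
  simp only [sub_zero]
  exact ⟨Int.floor_mono (by gcongr), Int.floor_mono (by gcongr)⟩

lemma injective : Function.Injective x := fun j k h => by
  by_contra hne
  have hsep : l ≤ |x j - x k| := hx.le_abs_sub hne
  rw [h, sub_self, abs_zero] at hsep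
  exact hsep.not_gt hx.pos

lemma half_le_norm_sub {z : ℂ} {j k : ι} (hz : ‖z - x k‖ ≤ l / 2) (hjk : j ≠ k) :
    l / 2 ≤ ‖z - x j‖ := by
  have hsep := hx.le_abs_sub hjk.symm
  have htri : |x k - x j| ≤ ‖z - x k‖ + ‖z - x j‖ := by
    rw [← Real.norm_eq_abs, ← Complex.norm_real, Complex.ofReal_sub, norm_sub_rev z]
    exact norm_sub_le_norm_sub_add_norm_sub _ _ _
  linarith

lemma half_le_norm_sub_of_norm_sub_eq {z : ℂ} {k : ι} (hz : ‖z - x k‖ = l / 2) (j : ι) :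
    l / 2 ≤ ‖z - x j‖ := by
  rcases eq_or_ne j k with rfl | hjk
  · exact hz.ge
  · exact hx.half_le_norm_sub hz.le hjk

lemma exists_pos_forall_le_norm_sub {z : ℂ} (hz : ∀ k, z ≠ x k) : ∃ δ > 0, ∀ k, δ ≤ ‖z - x k‖ := by
  have hclosed : IsClosed (Set.range fun k => (x k : ℂ)) := by
    refine Metric.isClosed_of_pairwise_le_dist hx.pos ?_
    rintro _ ⟨j, rfl⟩ _ ⟨k, rfl⟩ hne
    have hjk : j ≠ k := fun h => hne (by rw [h])
    simpa only [Complex.dist_eq, ← Complex.ofReal_sub, Complex.norm_real, Real.norm_eq_abs]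
      using hx.le_abs_sub hjk
  obtain ⟨δ, hδ, hball⟩ := Metric.isOpen_iff.1 hclosed.isOpen_compl z
    (by rintro ⟨k, hk⟩; exact hz k hk.symm)
  refine ⟨δ, hδ, fun k => ?_⟩
  by_contra! hlt
  exact hball (by rwa [Metric.mem_ball', dist_eq_norm]) ⟨k, rfl⟩

/-- The injection `k ↦ ⌊(x k - z.re) / l⌋` compares the sum with one over `ℤ`. -/
lemma sum_div_mul_add_le {t : ℝ} (ht : 0 ≤ t) (z : ℂ) (s : Finset ι) :
    ∑ k ∈ s, t / ((1 + ‖z - x k‖) * (1 + ‖z - x k‖ + t)) ≤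
      2 * (2 + l⁻¹) ^ 2 * (1 + Real.log (1 + t)) := by
  have hpos := hx.pos
  let n (k : ι) : ℤ := ⌊(x k - z.re) / l⌋
  have hn (k : ι) : 1 + |(n k : ℝ)| ≤ (2 + l⁻¹) * (1 + ‖z - x k‖) := by
    refine (hx.one_add_abs_floor_le z.re k).trans ?_
    gcongr
    simpa using Complex.abs_re_le_norm (z - x k)
  have hterm (k : ι) : t / ((1 + ‖z - x k‖) * (1 + ‖z - x k‖ + t)) ≤
      (2 + l⁻¹) ^ 2 * (t / ((1 + |(n k : ℝ)|) * (1 + |(n k : ℝ)| + t))) := by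
    have hn' : 1 + |(n k : ℝ)| + t ≤ (2 + l⁻¹) * (1 + ‖z - x k‖ + t) := by
      nlinarith [hn k, inv_pos.2 hpos]
    rw [← mul_div_assoc, div_le_div_iff₀ (by positivity) (by positivity)]
    calc t * ((1 + |(n k : ℝ)|) * (1 + |(n k : ℝ)| + t))
        ≤ t * ((2 + l⁻¹) * (1 + ‖z - x k‖) * ((2 + l⁻¹) * (1 + ‖z - x k‖ + t))) := by
          gcongr
          exact hn k
      _ = (2 + l⁻¹) ^ 2 * t * ((1 + ‖z - x k‖) * (1 + ‖z - x k‖ + t)) := by ring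
  calc ∑ k ∈ s, t / ((1 + ‖z - x k‖) * (1 + ‖z - x k‖ + t))
      ≤ (2 + l⁻¹) ^ 2 * ∑ k ∈ s, t / ((1 + |(n k : ℝ)|) * (1 + |(n k : ℝ)| + t)) := by
        rw [Finset.mul_sum]
        exact Finset.sum_le_sum fun k _ => hterm k
    _ = (2 + l⁻¹) ^ 2 *
          ∑ m ∈ s.image n, t / ((1 + |(m : ℝ)|) * (1 + |(m : ℝ)| + t)) := by
        rw [Finset.sum_image (hx.floor_injective z.re).injOn]
    _ ≤ (2 + l⁻¹) ^ 2 * (2 * (1 + Real.log (1 + t))) := by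
        gcongr
        exact sum_int_div_mul_add_le ht _
    _ = 2 * (2 + l⁻¹) ^ 2 * (1 + Real.log (1 + t)) := by ring

lemma sum_inv_one_add_norm_sub_sq_le (z : ℂ) (s : Finset ι) :
    ∑ k ∈ s, ((1 + ‖z - x k‖) ^ 2)⁻¹ ≤ 4 * (2 + l⁻¹) ^ 2 * (1 + Real.log 2) := by
  have hterm (k : ι) : ((1 + ‖z - x k‖) ^ 2)⁻¹ ≤
      2 * (1 / ((1 + ‖z - x k‖) * (1 + ‖z - x k‖ + 1))) := by
    rw [← one_div, ← mul_div_assoc, div_le_div_iff₀ (by positivity) (by positivity)]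
    nlinarith [norm_nonneg (z - x k)]
  calc ∑ k ∈ s, ((1 + ‖z - x k‖) ^ 2)⁻¹
      ≤ 2 * ∑ k ∈ s, 1 / ((1 + ‖z - x k‖) * (1 + ‖z - x k‖ + 1)) := by
        rw [Finset.mul_sum]
        exact Finset.sum_le_sum fun k _ => hterm k
    _ ≤ 2 * (2 * (2 + l⁻¹) ^ 2 * (1 + Real.log (1 + 1))) := by
        gcongr
        exact hx.sum_div_mul_add_le zero_le_one z s
    _ = 4 * (2 + l⁻¹) ^ 2 * (1 + Real.log 2) := by norm_num; ring

lemma sum_norm_sub_div_mul_le (w z : ℂ) (s : Finset ι) :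
    ∑ k ∈ s, ‖z - w‖ / ((1 + ‖z - x k‖) * (1 + ‖w - x k‖)) ≤
      12 * (2 + l⁻¹) ^ 2 * (1 + Real.log (1 + ‖z - w‖)) := by
  have hterm (k : ι) : ‖z - w‖ / ((1 + ‖z - x k‖) * (1 + ‖w - x k‖)) ≤
      3 * (‖z - w‖ / ((1 + ‖z - x k‖) * (1 + ‖z - x k‖ + ‖z - w‖)) +
        ‖z - w‖ / ((1 + ‖w - x k‖) * (1 + ‖w - x k‖ + ‖z - w‖))) := by
    refine div_mul_le_three_mul_add (by positivity) (by positivity) (norm_nonneg _) ?_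
    have := norm_sub_le_norm_sub_add_norm_sub z (x k : ℂ) w
    rw [norm_sub_rev (x k : ℂ)] at this
    linarith
  calc ∑ k ∈ s, ‖z - w‖ / ((1 + ‖z - x k‖) * (1 + ‖w - x k‖))
      ≤ 3 * (∑ k ∈ s, ‖z - w‖ / ((1 + ‖z - x k‖) * (1 + ‖z - x k‖ + ‖z - w‖)) +
          ∑ k ∈ s, ‖z - w‖ / ((1 + ‖w - x k‖) * (1 + ‖w - x k‖ + ‖z - w‖))) := by
        rw [← Finset.sum_add_distrib, Finset.mul_sum]
        exact Finset.sum_le_sum fun k _ => hterm k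
    _ ≤ 3 * (2 * (2 + l⁻¹) ^ 2 * (1 + Real.log (1 + ‖z - w‖)) +
          2 * (2 + l⁻¹) ^ 2 * (1 + Real.log (1 + ‖z - w‖))) := by
        gcongr <;> exact hx.sum_div_mul_add_le (norm_nonneg _) _ s
    _ = 12 * (2 + l⁻¹) ^ 2 * (1 + Real.log (1 + ‖z - w‖)) := by ring

end IsSeparatedBy

/-! ### Simple zeros and Lagrange interpolation -/

section Lagrange

variable {ι : Type*} {S f g : ℂ → ℂ} {p : ι → ℂ} {N : Finset ι} {c z w : ℂ} {R : ℝ}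

lemma differentiable_dslope (hS : Differentiable ℂ S) (w : ℂ) :
    Differentiable ℂ (dslope S w) := by
  rw [← differentiableOn_univ]
  exact (Complex.differentiableOn_dslope univ_mem).2 hS.differentiableOn

lemma sub_mul_dslope (hw : S w = 0) (z : ℂ) : (z - w) * dslope S w z = S z := by
  simpa only [hw, smul_eq_mul, sub_zero] using sub_smul_dslope S w z

lemma dslope_of_ne_of_eq_zero (hw : S w = 0) (hz : z ≠ w) : dslope S w z = S z / (z - w) := by
  rw [eq_div_iff (sub_ne_zero.2 hz), mul_comm, sub_mul_dslope hw]

lemma deriv_dslope_of_eq_zero (hS : Differentiable ℂ S) (hw : S w = 0) (hz : S z = 0)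
    (hne : z ≠ w) : deriv (dslope S w) z = deriv S z / (z - w) := by
  have hderiv : deriv (fun u => (u - w) * dslope S w u) z =
      dslope S w z + (z - w) * deriv (dslope S w) z := by
    rw [deriv_fun_mul (by fun_prop) (differentiable_dslope hS w z)]
    simp
  simp only [sub_mul_dslope hw, dslope_of_ne_of_eq_zero hw hne, hz, zero_div, zero_add] at hderiv
  rw [hderiv, mul_div_cancel_left₀ _ (sub_ne_zero.2 hne)]

/-- The zeros of `S` in the closed ball are exactly the points `p k`, `k ∈ N`; they are simple
and lie in the open ball. -/
structure HasSimpleZerosInBall (S : ℂ → ℂ) (p : ι → ℂ) (N : Finset ι) (c : ℂ) (R : ℝ) :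
    Prop where
  injOn : Set.InjOn p N
  mem_ball : ∀ k ∈ N, p k ∈ Metric.ball c R
  apply_eq_zero : ∀ k ∈ N, S (p k) = 0
  deriv_ne_zero : ∀ k ∈ N, deriv S (p k) ≠ 0
  exists_eq : ∀ z ∈ Metric.closedBall c R, S z = 0 → ∃ k ∈ N, z = p k

lemma HasSimpleZerosInBall.ne_zero_of_mem_sphere (h : HasSimpleZerosInBall S p N c R)
    (hz : z ∈ Metric.sphere c R) : S z ≠ 0 := fun hSz => by
  obtain ⟨k, hk, rfl⟩ := h.exists_eq z (Metric.sphere_subset_closedBall hz) hSz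
  exact (Metric.mem_ball.1 (h.mem_ball k hk)).ne hz

lemma HasSimpleZerosInBall.apply_ne_of_notMem [DecidableEq ι] {j k : ι}
    (h : HasSimpleZerosInBall S p (insert j N) c R) (hj : j ∉ N) (hk : k ∈ N) : p k ≠ p j :=
  fun hkj => hj <| by
    rwa [← h.injOn (Finset.mem_insert_of_mem hk) (Finset.mem_insert_self j N) hkj]

lemma HasSimpleZerosInBall.dslope [DecidableEq ι] {j : ι} (hS : Differentiable ℂ S) (hj : j ∉ N)
    (h : HasSimpleZerosInBall S p (insert j N) c R) :
    HasSimpleZerosInBall (dslope S (p j)) p N c R := by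
  have hSj : S (p j) = 0 := h.apply_eq_zero j (Finset.mem_insert_self j N)
  have hne : ∀ k ∈ N, p k ≠ p j := fun k hk => h.apply_ne_of_notMem hj hk
  refine ⟨h.injOn.mono (Finset.coe_subset.2 (Finset.subset_insert j N)),
    fun k hk => h.mem_ball k (Finset.mem_insert_of_mem hk), fun k hk => ?_, fun k hk => ?_,
    fun z hz hz₀ => ?_⟩
  · rw [dslope_of_ne_of_eq_zero hSj (hne k hk), h.apply_eq_zero k (Finset.mem_insert_of_mem hk),
      zero_div]
  · rw [deriv_dslope_of_eq_zero hS hSj (h.apply_eq_zero k (Finset.mem_insert_of_mem hk))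
      (hne k hk)]
    exact div_ne_zero (h.deriv_ne_zero k (Finset.mem_insert_of_mem hk))
      (sub_ne_zero.2 (hne k hk))
  · obtain ⟨k, hk, rfl⟩ := h.exists_eq z hz (by rw [← sub_mul_dslope hSj, hz₀, mul_zero])
    refine ⟨k, (Finset.mem_insert.1 hk).resolve_left ?_, rfl⟩
    rintro rfl
    exact h.deriv_ne_zero k hk (by rwa [dslope_same] at hz₀)

/-- The numerator, over the denominator `dslope S w`, of the difference between `g / S` and its
principal part at the simple zero `w` of `S`. -/
noncomputable def subPrincipalPart (g S : ℂ → ℂ) (w : ℂ) : ℂ → ℂ :=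
  dslope (fun u => g u - g w / deriv S w * dslope S w u) w

lemma differentiable_subPrincipalPart (hg : Differentiable ℂ g) (hS : Differentiable ℂ S) (w : ℂ) :
    Differentiable ℂ (subPrincipalPart g S w) :=
  differentiable_dslope (hg.sub ((differentiable_dslope hS w).const_mul _)) w

lemma sub_mul_subPrincipalPart (hw' : deriv S w ≠ 0) (z : ℂ) :
    (z - w) * subPrincipalPart g S w z = g z - g w / deriv S w * dslope S w z :=
  sub_mul_dslope (by rw [dslope_same, div_mul_cancel₀ _ hw', sub_self]) z

lemma div_eq_principalPart_add (hw : S w = 0) (hw' : deriv S w ≠ 0) (hz : S z ≠ 0) :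
    g z / S z =
      g w / deriv S w * (z - w)⁻¹ + subPrincipalPart g S w z / dslope S w z := by
  have hzw : z - w ≠ 0 := fun h => hz (by rw [← sub_mul_dslope hw, h, zero_mul])
  have hT : dslope S w z ≠ 0 := fun h => hz (by rw [← sub_mul_dslope hw, h, mul_zero])
  rw [← sub_mul_dslope hw z, ← mul_div_mul_left (subPrincipalPart g S w z) _ hzw,
    sub_mul_subPrincipalPart hw']
  field_simp
  ring

lemma subPrincipalPart_div_deriv_dslope (hS : Differentiable ℂ S) (hw : S w = 0)
    (hw' : deriv S w ≠ 0) (hz : S z = 0) (hne : z ≠ w) :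
    subPrincipalPart g S w z / deriv (dslope S w) z = g z / deriv S z := by
  have hzw := sub_ne_zero.2 hne
  rw [deriv_dslope_of_eq_zero hS hw hz hne, ← mul_div_mul_left (subPrincipalPart g S w z) _ hzw,
    sub_mul_subPrincipalPart hw', dslope_of_ne_of_eq_zero hw hne, hz, zero_div, mul_zero, sub_zero,
    mul_div_cancel₀ _ hzw]

/-- The residue theorem for a quotient with simple poles, which are split off one by one. -/
lemma circleIntegral_div_eq_sum (hR : 0 ≤ R) (hS : Differentiable ℂ S) (hg : Differentiable ℂ g)
    (h : HasSimpleZerosInBall S p N c R) :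
    ∮ ζ in C(c, R), g ζ / S ζ = 2 * Real.pi * Complex.I * ∑ k ∈ N, g (p k) / deriv S (p k) := by
  classical
  induction N using Finset.induction_on generalizing S g with
  | empty =>
    rw [Finset.sum_empty, mul_zero]
    refine DiffContOnCl.circleIntegral_eq_zero hR ?_
    refine DifferentiableOn.diffContOnCl_ball (U := Metric.closedBall c R)
      (fun z hz => ?_) Set.Subset.rfl
    have hSz : S z ≠ 0 := fun hz₀ => by simpa using h.exists_eq z hz hz₀
    exact ((hg z).div (hS z) hSz).differentiableWithinAt
  | insert j N hj ih =>
    have hSj : S (p j) = 0 := h.apply_eq_zero j (Finset.mem_insert_self j N)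
    have hdj : deriv S (p j) ≠ 0 := h.deriv_ne_zero j (Finset.mem_insert_self j N)
    have hball := h.mem_ball j (Finset.mem_insert_self j N)
    have hTdiff := differentiable_dslope hS (p j)
    have hTzeros : HasSimpleZerosInBall (dslope S (p j)) p N c R := h.dslope hS hj
    have hGdiff := differentiable_subPrincipalPart hg hS (p j)
    have hsplit : Set.EqOn (fun ζ => g ζ / S ζ) (fun ζ => g (p j) / deriv S (p j) * (ζ - p j)⁻¹ +
        subPrincipalPart g S (p j) ζ / dslope S (p j) ζ) (Metric.sphere c R) :=
      fun ζ hζ => div_eq_principalPart_add hSj hdj (h.ne_zero_of_mem_sphere hζ)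
    have hint₁ : CircleIntegrable (fun ζ => g (p j) / deriv S (p j) * (ζ - p j)⁻¹) c R :=
      (continuousOn_const.mul (ContinuousOn.inv₀ (by fun_prop) fun ζ hζ =>
        sub_ne_zero.2 (Metric.sphere_disjoint_ball.ne_of_mem hζ hball))).circleIntegrable hR
    have hint₂ : CircleIntegrable
        (fun ζ => subPrincipalPart g S (p j) ζ / dslope S (p j) ζ) c R :=
      (hGdiff.continuous.continuousOn.div hTdiff.continuous.continuousOn
        fun ζ hζ => hTzeros.ne_zero_of_mem_sphere hζ).circleIntegrable hR
    have hresidue : ∀ k ∈ N, subPrincipalPart g S (p j) (p k) / deriv (dslope S (p j)) (p k) =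
        g (p k) / deriv S (p k) := fun k hk =>
      subPrincipalPart_div_deriv_dslope hS hSj hdj
        (h.apply_eq_zero k (Finset.mem_insert_of_mem hk)) (h.apply_ne_of_notMem hj hk)
    rw [circleIntegral.integral_congr hR hsplit, circleIntegral.integral_add hint₁ hint₂,
      circleIntegral.integral_const_mul, circleIntegral.integral_sub_inv_of_mem_ball hball,
      ih hTdiff hGdiff hTzeros, Finset.sum_congr rfl hresidue, Finset.sum_insert hj]
    ring

/-- The entire function with value `1` at the simple zero `w` of `S` that vanishes at the other
zeros of `S`. -/
noncomputable def lagrangeKernel (S : ℂ → ℂ) (w z : ℂ) : ℂ :=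
  dslope S w z / deriv S w

/-- Lagrange interpolation at the zeros of `S`, with the remainder as a contour integral: the
residues of `ζ ↦ (S z * f ζ - f z * S ζ) / ((ζ - z) * S ζ)`, in which `z` is removable. -/
lemma sub_sum_mul_lagrangeKernel_eq (hS : Differentiable ℂ S) (hf : Differentiable ℂ f)
    (h : HasSimpleZerosInBall S p N c R) (hz : z ∈ Metric.ball c R) :
    f z - ∑ k ∈ N, f (p k) * lagrangeKernel S (p k) z =
      S z * ((2 * Real.pi * Complex.I)⁻¹ * ∮ ζ in C(c, R), f ζ / S ζ * (ζ - z)⁻¹) := by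
  have hR : 0 ≤ R := (Metric.pos_of_mem_ball hz).le
  have hne : ∀ ζ ∈ Metric.sphere c R, ζ - z ≠ 0 := fun ζ hζ =>
    sub_ne_zero.2 (Metric.sphere_disjoint_ball.ne_of_mem hζ hz)
  set H : ℂ → ℂ := fun ζ => S z * f ζ - f z * S ζ with hH
  have hHdiff : Differentiable ℂ H := (hf.const_mul _).sub (hS.const_mul _)
  have hHz : H z = 0 := by simp only [hH, mul_comm, sub_self]
  have hsplit : Set.EqOn (fun ζ => dslope H z ζ / S ζ)
      (fun ζ => S z * (f ζ / S ζ * (ζ - z)⁻¹) - f z * (ζ - z)⁻¹) (Metric.sphere c R) :=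
    fun ζ hζ => by
      have hSζ := h.ne_zero_of_mem_sphere hζ
      have hζz := hne ζ hζ
      simp only [dslope_of_ne_of_eq_zero hHz (sub_ne_zero.1 hζz)]
      simp only [hH]
      field_simp
  have hint₁ : CircleIntegrable (fun ζ => S z * (f ζ / S ζ * (ζ - z)⁻¹)) c R :=
    (continuousOn_const.mul ((hf.continuous.continuousOn.div hS.continuous.continuousOn
      fun ζ hζ => h.ne_zero_of_mem_sphere hζ).mul
        (ContinuousOn.inv₀ (by fun_prop) hne))).circleIntegrable hR
  have hint₂ : CircleIntegrable (fun ζ => f z * (ζ - z)⁻¹) c R :=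
    (continuousOn_const.mul (ContinuousOn.inv₀ (by fun_prop) hne)).circleIntegrable hR
  have hresidue : ∀ k ∈ N, dslope H z (p k) / deriv S (p k) =
      -(f (p k) * lagrangeKernel S (p k) z) := fun k hk => by
    have hSk := h.apply_eq_zero k hk
    rw [lagrangeKernel, ← mul_div_assoc, ← neg_div]
    congr 1
    rcases eq_or_ne (p k) z with rfl | hkz
    · simp only [dslope_same, hH, hSk, zero_mul, zero_sub]
      simp
    · rw [dslope_of_ne_of_eq_zero hHz hkz, dslope_of_ne_of_eq_zero hSk hkz.symm, ← neg_sub z]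
      simp only [hH, hSk, mul_zero, sub_zero, div_neg]
      ring
  have hresidues := circleIntegral_div_eq_sum hR hS (differentiable_dslope hHdiff z) h
  rw [Finset.sum_congr rfl hresidue, Finset.sum_neg_distrib,
    circleIntegral.integral_congr hR hsplit, circleIntegral.integral_sub hint₁ hint₂,
    circleIntegral.integral_const_mul, circleIntegral.integral_const_mul,
    circleIntegral.integral_sub_inv_of_mem_ball hz] at hresidues
  linear_combination -(2 * Real.pi * Complex.I)⁻¹ * hresidues -
    (f z - ∑ k ∈ N, f (p k) * lagrangeKernel S (p k) z) *
      inv_mul_cancel₀ Complex.two_pi_I_ne_zero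

end Lagrange

/-! ### Functions of sine type -/

lemma norm_le_of_forall_mem_sphere {g : ℂ → ℂ} {c z : ℂ} {R B : ℝ} (hR : R ≠ 0)
    (hg : DiffContOnCl ℂ g (Metric.ball c R)) (hB : ∀ w ∈ Metric.sphere c R, ‖g w‖ ≤ B)
    (hz : z ∈ Metric.closedBall c R) : ‖g z‖ ≤ B :=
  Complex.norm_le_of_forall_mem_frontier_norm_le Metric.isBounded_ball hg
    (fun w hw => hB w (frontier_ball c hR ▸ hw)) (closure_ball c hR ▸ hz)

lemma le_norm_of_forall_mem_sphere {g : ℂ → ℂ} {c z : ℂ} {R B : ℝ} (hR : R ≠ 0) (hB₀ : 0 < B)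
    (hg : DiffContOnCl ℂ g (Metric.ball c R)) (hg₀ : ∀ w ∈ Metric.closedBall c R, g w ≠ 0)
    (hB : ∀ w ∈ Metric.sphere c R, B ≤ ‖g w‖) (hz : z ∈ Metric.closedBall c R) : B ≤ ‖g z‖ := by
  have hinv : ‖(g z)⁻¹‖ ≤ B⁻¹ :=
    norm_le_of_forall_mem_sphere (g := g⁻¹) hR
      (hg.inv fun w hw => hg₀ w (closure_ball c hR ▸ hw))
      (fun w hw => by
        rw [Pi.inv_apply, norm_inv]
        exact inv_anti₀ hB₀ (hB w hw)) hz
  rw [norm_inv] at hinv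
  exact (inv_le_inv₀ (norm_pos_iff.2 (hg₀ z hz)) hB₀).1 hinv

lemma exp_mul_abs_im_le (b : ℝ) (w z : ℂ) :
    Real.exp (Real.pi * b * |w.im|) ≤
      Real.exp (Real.pi * |b| * ‖w - z‖) * Real.exp (Real.pi * b * |z.im|) := by
  rw [← Real.exp_add, Real.exp_le_exp]
  have him : |(|w.im| - |z.im|)| ≤ ‖w - z‖ :=
    (abs_abs_sub_abs_le _ _).trans (by simpa using Complex.abs_im_le_norm (w - z))
  have hb : b * (|w.im| - |z.im|) ≤ |b| * ‖w - z‖ :=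
    (le_abs_self _).trans (by rw [abs_mul]; gcongr)
  nlinarith [Real.pi_pos]

lemma norm_le_mul_exp_of_forall_mem_sphere {g : ℂ → ℂ} {c z : ℂ} {b R B : ℝ} (hR : 0 < R)
    (hB₀ : 0 ≤ B) (hg : Differentiable ℂ g)
    (hB : ∀ w ∈ Metric.sphere c R, ‖g w‖ ≤ B * Real.exp (Real.pi * b * |w.im|))
    (hz : z ∈ Metric.closedBall c R) :
    ‖g z‖ ≤ B * Real.exp (Real.pi * |b| * (2 * R)) * Real.exp (Real.pi * b * |z.im|) := by
  refine norm_le_of_forall_mem_sphere hR.ne' hg.diffContOnCl (fun w hw => ?_) hz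
  have hwz : ‖w - z‖ ≤ 2 * R := by
    rw [← dist_eq_norm, two_mul]
    exact (dist_triangle_right w z c).trans (add_le_add (Metric.mem_sphere.1 hw).le hz)
  calc ‖g w‖ ≤ B * Real.exp (Real.pi * b * |w.im|) := hB w hw
    _ ≤ B * (Real.exp (Real.pi * |b| * ‖w - z‖) * Real.exp (Real.pi * b * |z.im|)) := by
        gcongr
        exact exp_mul_abs_im_le b w z
    _ ≤ B * (Real.exp (Real.pi * |b| * (2 * R)) * Real.exp (Real.pi * b * |z.im|)) := by gcongr
    _ = _ := (mul_assoc _ _ _).symm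

/-- An entire function with simple zeros at the points `x k` whose modulus is comparable to
`exp (π b |Im z|)` at any positive distance from these points. -/
structure IsSineType {ι : Type*} (x : ι → ℝ) (S : ℂ → ℂ) (b : ℝ) : Prop where
  differentiable : Differentiable ℂ S
  apply_eq_zero : ∀ k, S (x k) = 0
  deriv_ne_zero : ∀ k, deriv S (x k) ≠ 0
  exists_le_norm : ∀ ε > 0, ∃ c > 0, ∀ z : ℂ, (∀ k, ε ≤ ‖z - x k‖) →
    c * Real.exp (Real.pi * b * |z.im|) ≤ ‖S z‖
  exists_norm_le : ∀ ε > 0, ∃ C, ∀ z : ℂ, (∀ k, ε ≤ ‖z - x k‖) →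
    ‖S z‖ ≤ C * Real.exp (Real.pi * b * |z.im|)

namespace IsSineType

variable {ι : Type*} {x : ι → ℝ} {S : ℂ → ℂ} {b l : ℝ} (hS : IsSineType x S b)
  (hx : IsSeparatedBy l x)
include hS hx

lemma exists_eq_of_apply_eq_zero {z : ℂ} (hz : S z = 0) : ∃ k, z = x k := by
  by_contra! hne
  obtain ⟨δ, hδ, hδz⟩ := hx.exists_pos_forall_le_norm_sub hne
  obtain ⟨c, hc, hcS⟩ := hS.exists_le_norm δ hδ
  have hpos : 0 < ‖S z‖ := lt_of_lt_of_le (by positivity) (hcS z hδz)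
  exact norm_pos_iff.1 hpos hz

lemma exists_norm_le_mul_exp : ∃ C ≥ 0, ∀ z, ‖S z‖ ≤ C * Real.exp (Real.pi * b * |z.im|) := by
  have hl : 0 < l / 2 := half_pos hx.pos
  obtain ⟨C, hC⟩ := hS.exists_norm_le (l / 2) hl
  have hfar : ∀ z : ℂ, (∀ k, l / 2 ≤ ‖z - x k‖) →
      ‖S z‖ ≤ |C| * Real.exp (Real.pi * b * |z.im|) := fun z hz =>
    (hC z hz).trans (by gcongr; exact le_abs_self C)
  have hgrow : 1 ≤ Real.exp (Real.pi * |b| * (2 * (l / 2))) := Real.one_le_exp (by positivity)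
  refine ⟨|C| * Real.exp (Real.pi * |b| * (2 * (l / 2))), by positivity, fun z => ?_⟩
  by_cases hz : ∀ k, l / 2 ≤ ‖z - x k‖
  · refine (hfar z hz).trans ?_
    gcongr
    exact le_mul_of_one_le_right (abs_nonneg C) hgrow
  · push Not at hz
    obtain ⟨k, hk⟩ := hz
    refine norm_le_mul_exp_of_forall_mem_sphere (c := x k) hl (abs_nonneg C) hS.differentiable
      (fun w hw => hfar w (hx.half_le_norm_sub_of_norm_sub_eq (mem_sphere_iff_norm.1 hw)))
      (mem_closedBall_iff_norm.2 hk.le)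

lemma exists_norm_dslope_mul_le : ∃ C ≥ 0, ∀ k z,
    ‖dslope S (x k) z‖ * (1 + ‖z - x k‖) ≤ C * Real.exp (Real.pi * b * |z.im|) := by
  have hl : 0 < l / 2 := half_pos hx.pos
  obtain ⟨C, hC₀, hC⟩ := hS.exists_norm_le_mul_exp hx
  have hmul (k : ι) (z : ℂ) :
      ‖dslope S (x k) z‖ * ‖z - x k‖ ≤ C * Real.exp (Real.pi * b * |z.im|) := by
    rw [mul_comm, ← norm_mul, sub_mul_dslope (hS.apply_eq_zero k)]
    exact hC z
  have hfar (k : ι) (z : ℂ) (hz : l / 2 ≤ ‖z - x k‖) :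
      ‖dslope S (x k) z‖ ≤ C / (l / 2) * Real.exp (Real.pi * b * |z.im|) := by
    rw [div_mul_eq_mul_div, le_div_iff₀ hl]
    exact (mul_le_mul_of_nonneg_left hz (norm_nonneg _)).trans (hmul k z)
  set E := Real.exp (Real.pi * |b| * (2 * (l / 2)))
  have hE : 1 ≤ E := Real.one_le_exp (by positivity)
  have hdslope (k : ι) (z : ℂ) :
      ‖dslope S (x k) z‖ ≤ C / (l / 2) * E * Real.exp (Real.pi * b * |z.im|) := by
    rcases le_total (l / 2) ‖z - x k‖ with hz | hz
    · refine (hfar k z hz).trans ?_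
      gcongr
      exact le_mul_of_one_le_right (by positivity) hE
    · exact norm_le_mul_exp_of_forall_mem_sphere hl (by positivity)
        (differentiable_dslope hS.differentiable _)
        (fun w hw => hfar k w (mem_sphere_iff_norm.1 hw).ge) (mem_closedBall_iff_norm.2 hz)
  refine ⟨C / (l / 2) * E + C, by positivity, fun k z => ?_⟩
  rw [mul_add, mul_one, add_mul]
  exact add_le_add (hdslope k z) (hmul k z)

lemma exists_le_norm_deriv : ∃ c > 0, ∀ k, c ≤ ‖deriv S (x k)‖ := by
  have hl : 0 < l / 2 := half_pos hx.pos
  obtain ⟨c, hc, hcS⟩ := hS.exists_le_norm (l / 2) hl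
  refine ⟨c * Real.exp (-(Real.pi * |b| * (l / 2))) / (l / 2), by positivity, fun k => ?_⟩
  rw [← dslope_same]
  refine le_norm_of_forall_mem_sphere hl.ne' (by positivity)
    (differentiable_dslope hS.differentiable _).diffContOnCl (fun w hw hw₀ => ?_)
    (fun w hw => ?_) (Metric.mem_closedBall_self hl.le)
  · obtain ⟨j, rfl⟩ := hS.exists_eq_of_apply_eq_zero hx
      (z := w) (by rw [← sub_mul_dslope (hS.apply_eq_zero k), hw₀, mul_zero])
    rcases eq_or_ne j k with rfl | hjk
    · exact hS.deriv_ne_zero j (by rwa [dslope_same] at hw₀)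
    · have := hx.half_le_norm_sub (mem_closedBall_iff_norm.1 hw) hjk
      rw [sub_self, norm_zero] at this
      exact this.not_gt hl
  · have hwk : ‖w - x k‖ = l / 2 := mem_sphere_iff_norm.1 hw
    have hlower : c * Real.exp (Real.pi * b * |w.im|) ≤ ‖S w‖ :=
      hcS w (hx.half_le_norm_sub_of_norm_sub_eq hwk)
    have hexp : Real.exp (-(Real.pi * |b| * (l / 2))) ≤ Real.exp (Real.pi * b * |w.im|) := by
      rw [Real.exp_neg, inv_le_iff_one_le_mul₀' (Real.exp_pos _)]
      simpa [← hwk, norm_sub_rev] using exp_mul_abs_im_le b (x k) w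
    rw [div_le_iff₀ hl, ← hwk, mul_comm ‖dslope S _ w‖, ← norm_mul,
      sub_mul_dslope (hS.apply_eq_zero k), hwk]
    exact (mul_le_mul_of_nonneg_left hexp hc.le).trans hlower

lemma exists_norm_lagrangeKernel_mul_le : ∃ C ≥ 0, ∀ k z,
    ‖lagrangeKernel S (x k) z‖ * (1 + ‖z - x k‖) ≤ C * Real.exp (Real.pi * b * |z.im|) := by
  obtain ⟨C, hC₀, hC⟩ := hS.exists_norm_dslope_mul_le hx
  obtain ⟨c, hc, hderiv⟩ := hS.exists_le_norm_deriv hx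
  refine ⟨C / c, by positivity, fun k z => ?_⟩
  rw [lagrangeKernel, norm_div, div_mul_eq_mul_div, div_mul_eq_mul_div]
  exact div_le_div₀ (by positivity) (hC k z) hc (hderiv k)

end IsSineType

lemma interpKernel_eq {x : ℤ → ℝ} {S : ℂ → ℂ} {xt : ℂ} {k : ℤ} (hS : Differentiable ℂ S)
    (hk : S (x k) = 0) (hxt : xt ≠ x k) (z : ℂ) :
    interpKernel x S xt k z = lagrangeKernel S (x k) z * ((xt - z) / (xt - x k)) := by
  have hcont : Continuous fun z => lagrangeKernel S (x k) z * ((xt - z) / (xt - x k)) :=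
    ((differentiable_dslope hS _).continuous.div_const _).mul (by fun_prop)
  refine (hcont.continuousAt.continuousWithinAt.tendsto.congr' ?_).limUnder_eq
  have hne : ∀ᶠ z₀ : ℂ in 𝓝[≠] z, z₀ ≠ x k := by
    rcases eq_or_ne z (x k) with rfl | hz
    · exact self_mem_nhdsWithin
    · exact eventually_ne_nhdsWithin hz
  filter_upwards [hne] with z₀ hz₀
  rw [lagrangeKernel, dslope_of_ne_of_eq_zero hk hz₀]
  have h₁ := sub_ne_zero.2 hz₀
  have h₂ := sub_ne_zero.2 hxt
  field_simp
  ring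

lemma interpKernel_eq_sub {x : ℤ → ℝ} {S : ℂ → ℂ} {xt : ℂ} {k : ℤ} (hS : Differentiable ℂ S)
    (hk : S (x k) = 0) (hxt : S xt ≠ 0) (z : ℂ) :
    interpKernel x S xt k z =
      lagrangeKernel S (x k) z - S z / S xt * lagrangeKernel S (x k) xt := by
  have hne : xt ≠ x k := fun h => hxt (h ▸ hk)
  have hsub := sub_ne_zero.2 hne
  rw [interpKernel_eq hS hk hne, lagrangeKernel, lagrangeKernel,
    dslope_of_ne_of_eq_zero hk hne, ← sub_mul_dslope hk z]
  field_simp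
  ring

/-! ### Interpolation of bounded data -/

section Interpolant

variable {x : ℤ → ℝ} {S : ℂ → ℂ} {b l : ℝ} {xt : ℂ}

lemma ne_ofReal_of_notMem_pointSet (hxt : xt ∉ pointSet x) (k : ℤ) : xt ≠ x k :=
  fun h => hxt ⟨k, h.symm⟩

lemma IsSineType.apply_ne_zero (hS : IsSineType x S b) (hx : IsSeparatedBy l x)
    (hxt : xt ∉ pointSet x) : S xt ≠ 0 := fun h => by
  obtain ⟨k, hk⟩ := hS.exists_eq_of_apply_eq_zero hx h
  exact ne_ofReal_of_notMem_pointSet hxt k hk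

lemma IsSineType.differentiable_interpKernel (hS : IsSineType x S b) (hxt : xt ∉ pointSet x)
    (k : ℤ) : Differentiable ℂ (interpKernel x S xt k) := by
  rw [funext (interpKernel_eq hS.differentiable (hS.apply_eq_zero k)
    (ne_ofReal_of_notMem_pointSet hxt k))]
  exact ((differentiable_dslope hS.differentiable _).div_const _).mul (by fun_prop)

lemma IsSineType.interpKernel_apply_xt (hS : IsSineType x S b) (hxt : xt ∉ pointSet x) (k : ℤ) :
    interpKernel x S xt k xt = 0 := by
  rw [interpKernel_eq hS.differentiable (hS.apply_eq_zero k) (ne_ofReal_of_notMem_pointSet hxt k),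
    sub_self, zero_div, mul_zero]

lemma IsSineType.interpKernel_apply_node (hS : IsSineType x S b) (hx : IsSeparatedBy l x)
    (hxt : xt ∉ pointSet x) (k j : ℤ) : interpKernel x S xt k (x j) = if k = j then 1 else 0 := by
  rw [interpKernel_eq_sub hS.differentiable (hS.apply_eq_zero k) (hS.apply_ne_zero hx hxt),
    hS.apply_eq_zero, zero_div, zero_mul, sub_zero, lagrangeKernel]
  split_ifs with h
  · rw [h, dslope_same, div_self (hS.deriv_ne_zero j)]
  · have hne : (x j : ℂ) ≠ x k := fun he => h (hx.injective (Complex.ofReal_injective he)).symm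
    rw [dslope_of_ne_of_eq_zero (hS.apply_eq_zero k) hne, hS.apply_eq_zero, zero_div, zero_div]

lemma IsSineType.exists_norm_interpKernel_le (hS : IsSineType x S b) (hx : IsSeparatedBy l x)
    (hxt : xt ∉ pointSet x) : ∃ C ≥ 0, ∀ k z, ‖interpKernel x S xt k z‖ ≤
      C * Real.exp (Real.pi * b * |z.im|) *
        (‖z - xt‖ / ((1 + ‖z - x k‖) * (1 + ‖xt - x k‖))) := by
  obtain ⟨C, hC₀, hC⟩ := hS.exists_norm_lagrangeKernel_mul_le hx
  obtain ⟨δ, hδ, hδx⟩ := hx.exists_pos_forall_le_norm_sub (ne_ofReal_of_notMem_pointSet hxt)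
  refine ⟨C * (1 + δ⁻¹), by positivity, fun k z => ?_⟩
  have hpos : 0 < ‖xt - x k‖ := hδ.trans_le (hδx k)
  have hfar : 1 + ‖xt - x k‖ ≤ (1 + δ⁻¹) * ‖xt - x k‖ := by
    have : 1 ≤ δ⁻¹ * ‖xt - x k‖ := by
      rw [inv_mul_eq_div, one_le_div hδ]
      exact hδx k
    linarith
  rw [interpKernel_eq hS.differentiable (hS.apply_eq_zero k) (ne_ofReal_of_notMem_pointSet hxt k),
    norm_mul, norm_div, norm_sub_rev xt z, ← mul_div_assoc, ← mul_div_assoc,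
    div_le_div_iff₀ hpos (by positivity)]
  calc ‖lagrangeKernel S (x k) z‖ * ‖z - xt‖ * ((1 + ‖z - x k‖) * (1 + ‖xt - x k‖))
      = ‖lagrangeKernel S (x k) z‖ * (1 + ‖z - x k‖) * ‖z - xt‖ * (1 + ‖xt - x k‖) := by ring
    _ ≤ C * Real.exp (Real.pi * b * |z.im|) * ‖z - xt‖ * ((1 + δ⁻¹) * ‖xt - x k‖) := by
        gcongr ?_ * _ * ?_
        exact hC k z
    _ = C * (1 + δ⁻¹) * Real.exp (Real.pi * b * |z.im|) * ‖z - xt‖ * ‖xt - x k‖ := by ring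

lemma log_one_add_norm_sub_le (w z : ℂ) :
    Real.log (1 + ‖z - w‖) ≤ Real.log (2 * (1 + ‖w‖)) + max (Real.log ‖z‖) 0 := by
  have hmax : 0 < max 1 ‖z‖ := lt_max_of_lt_left one_pos
  rw [max_comm, ← Real.posLog_apply, Real.posLog_eq_log_max_one (norm_nonneg z),
    ← Real.log_mul (by positivity) hmax.ne']
  refine Real.log_le_log (by positivity) ?_
  nlinarith [norm_sub_le z w, le_max_left 1 ‖z‖, le_max_right 1 ‖z‖, norm_nonneg w]

lemma IsSineType.exists_sum_norm_interpKernel_le (hS : IsSineType x S b)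
    (hx : IsSeparatedBy l x) (hxt : xt ∉ pointSet x) : ∃ C ≥ 0, ∀ (s : Finset ℤ) (z : ℂ),
      ∑ k ∈ s, ‖interpKernel x S xt k z‖ ≤
        C * Real.exp (Real.pi * b * |z.im|) * (1 + max (Real.log ‖z‖) 0) := by
  obtain ⟨C, hC₀, hC⟩ := hS.exists_norm_interpKernel_le hx hxt
  have hpos := hx.pos
  set L := Real.log (2 * (1 + ‖xt‖))
  have hL₀ : 0 ≤ L := Real.log_nonneg (by linarith [norm_nonneg xt])
  refine ⟨C * (12 * (2 + l⁻¹) ^ 2) * (1 + L), by positivity, fun s z => ?_⟩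
  have hlog : 1 + Real.log (1 + ‖z - xt‖) ≤ (1 + L) * (1 + max (Real.log ‖z‖) 0) := by
    nlinarith [log_one_add_norm_sub_le xt z, le_max_right (Real.log ‖z‖) 0]
  calc ∑ k ∈ s, ‖interpKernel x S xt k z‖
      ≤ C * Real.exp (Real.pi * b * |z.im|) *
          ∑ k ∈ s, ‖z - xt‖ / ((1 + ‖z - x k‖) * (1 + ‖xt - x k‖)) := by
        rw [Finset.mul_sum]
        exact Finset.sum_le_sum fun k _ => hC k z
    _ ≤ C * Real.exp (Real.pi * b * |z.im|) *
          (12 * (2 + l⁻¹) ^ 2 * ((1 + L) * (1 + max (Real.log ‖z‖) 0))) := by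
        gcongr
        refine (hx.sum_norm_sub_div_mul_le xt z s).trans ?_
        gcongr
    _ = _ := by ring

lemma IsSineType.exists_summable_norm_interpKernel_le (hS : IsSineType x S b)
    (hx : IsSeparatedBy l x) (hxt : xt ∉ pointSet x) (R : ℝ) :
    ∃ u : ℤ → ℝ, Summable u ∧
      ∀ k, ∀ z ∈ Metric.closedBall 0 R, ‖interpKernel x S xt k z‖ ≤ u k := by
  obtain ⟨C, hC₀, hC⟩ := hS.exists_norm_interpKernel_le hx hxt
  have hsum : Summable fun k => ((1 + ‖xt - x k‖) ^ 2)⁻¹ :=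
    summable_of_sum_le (fun k => by positivity) (hx.sum_inv_one_add_norm_sub_sq_le xt)
  refine ⟨_, hsum.mul_left (C * Real.exp (Real.pi * |b| * R) * ((R + ‖xt‖) * (1 + (R + ‖xt‖)))),
    fun k z hz => (hC k z).trans ?_⟩
  rw [mem_closedBall_zero_iff] at hz
  have hexp : Real.exp (Real.pi * b * |z.im|) ≤ Real.exp (Real.pi * |b| * R) := by
    refine (exp_mul_abs_im_le b z 0).trans ?_
    simp only [sub_zero, Complex.zero_im, abs_zero, mul_zero, Real.exp_zero, mul_one]
    gcongr
  have hT : ‖z - xt‖ ≤ R + ‖xt‖ := (norm_sub_le z xt).trans (by gcongr)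
  have htri : 1 + ‖xt - x k‖ ≤ (1 + (R + ‖xt‖)) * (1 + ‖z - x k‖) := by
    have := norm_sub_le_norm_sub_add_norm_sub xt z (x k : ℂ)
    rw [norm_sub_rev xt z] at this
    nlinarith [norm_nonneg (z - x k), norm_nonneg (z - xt)]
  have hT₀ : 0 ≤ R + ‖xt‖ := (norm_nonneg _).trans hT
  have hfrac : ‖z - xt‖ / ((1 + ‖z - x k‖) * (1 + ‖xt - x k‖)) ≤
      (R + ‖xt‖) * (1 + (R + ‖xt‖)) * ((1 + ‖xt - x k‖) ^ 2)⁻¹ := by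
    rw [← div_eq_mul_inv, div_le_div_iff₀ (by positivity) (by positivity)]
    calc ‖z - xt‖ * (1 + ‖xt - x k‖) ^ 2
        = ‖z - xt‖ * (1 + ‖xt - x k‖) * (1 + ‖xt - x k‖) := by ring
      _ ≤ (R + ‖xt‖) * ((1 + (R + ‖xt‖)) * (1 + ‖z - x k‖)) * (1 + ‖xt - x k‖) := by gcongr
      _ = _ := by ring
  rw [mul_assoc (C * _)]
  gcongr

/-- The sum of the interpolation series with data `ta` at `xt` and `a k` at `x k`. -/
noncomputable def interpolant (x : ℤ → ℝ) (S : ℂ → ℂ) (xt ta : ℂ) (a : ℤ → ℂ) (z : ℂ) : ℂ :=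
  ta * (S z / S xt) + ∑' k, a k * interpKernel x S xt k z

variable {ta : ℂ} {a : ℤ → ℂ} {A : ℝ}

lemma IsSineType.interpolant_apply_xt (hS : IsSineType x S b) (hx : IsSeparatedBy l x)
    (hxt : xt ∉ pointSet x) : interpolant x S xt ta a xt = ta := by
  simp [interpolant, hS.interpKernel_apply_xt hxt, hS.apply_ne_zero hx hxt]

lemma IsSineType.interpolant_apply_node (hS : IsSineType x S b) (hx : IsSeparatedBy l x)
    (hxt : xt ∉ pointSet x) (j : ℤ) : interpolant x S xt ta a (x j) = a j := by
  simp [interpolant, hS.interpKernel_apply_node hx hxt, hS.apply_eq_zero]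

lemma IsSineType.exists_summable_norm_mul_interpKernel_le (hS : IsSineType x S b)
    (hx : IsSeparatedBy l x) (hxt : xt ∉ pointSet x) (ha : ∀ k, ‖a k‖ ≤ A) (R : ℝ) :
    ∃ u : ℤ → ℝ, Summable u ∧
      ∀ k, ∀ z ∈ Metric.closedBall 0 R, ‖a k * interpKernel x S xt k z‖ ≤ u k := by
  obtain ⟨u, hu, hle⟩ := hS.exists_summable_norm_interpKernel_le hx hxt R
  refine ⟨_, hu.mul_left A, fun k z hz => ?_⟩
  rw [norm_mul]
  exact mul_le_mul (ha k) (hle k z hz) (norm_nonneg _) ((norm_nonneg _).trans (ha k))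

lemma IsSineType.differentiable_interpolant (hS : IsSineType x S b) (hx : IsSeparatedBy l x)
    (hxt : xt ∉ pointSet x) (ha : ∀ k, ‖a k‖ ≤ A) :
    Differentiable ℂ (interpolant x S xt ta a) := by
  refine ((hS.differentiable.div_const _).const_mul _).add fun z => ?_
  obtain ⟨u, hu, hle⟩ := hS.exists_summable_norm_mul_interpKernel_le hx hxt ha (‖z‖ + 1)
  have hdiff := Complex.differentiableOn_tsum_of_summable_norm hu
    (fun k => ((hS.differentiable_interpKernel hxt k).const_mul (a k)).differentiableOn)
    Metric.isOpen_ball fun k w hw => hle k w (Metric.ball_subset_closedBall hw)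
  exact hdiff.differentiableAt (Metric.isOpen_ball.mem_nhds (by simp))

lemma IsSineType.tendstoUniformlyOn_interpolant (hS : IsSineType x S b)
    (hx : IsSeparatedBy l x) (hxt : xt ∉ pointSet x) (ha : ∀ k, ‖a k‖ ≤ A) {K : Set ℂ}
    (hK : IsCompact K) :
    TendstoUniformlyOn (fun (s : Finset ℤ) z => interpPartialSum x S xt ta a s z)
      (interpolant x S xt ta a) atTop K := by
  obtain ⟨R, hR⟩ := hK.isBounded.subset_closedBall 0
  obtain ⟨u, hu, hle⟩ := hS.exists_summable_norm_mul_interpKernel_le hx hxt ha R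
  have hseries := tendstoUniformlyOn_tsum hu fun k z hz => hle k z (hR hz)
  rw [Metric.tendstoUniformlyOn_iff] at hseries ⊢
  simpa only [interpPartialSum, interpolant, finsum_mem_coe_finset, dist_add_left] using hseries

lemma IsSineType.exists_norm_interpolant_le (hS : IsSineType x S b) (hx : IsSeparatedBy l x)
    (hxt : xt ∉ pointSet x) : ∃ C, ∀ (ta : ℂ) (a : ℤ → ℂ) (A : ℝ), (∀ k, ‖a k‖ ≤ A) → ‖ta‖ ≤ A →
      ∀ z, ‖interpolant x S xt ta a z‖ ≤
        C * A * Real.exp (Real.pi * b * |z.im|) * (1 + max (Real.log ‖z‖) 0) := by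
  obtain ⟨C, hC₀, hC⟩ := hS.exists_norm_le_mul_exp hx
  obtain ⟨D, -, hD⟩ := hS.exists_sum_norm_interpKernel_le hx hxt
  refine ⟨C / ‖S xt‖ + D, fun ta a A ha hta z => ?_⟩
  have hA : 0 ≤ A := (norm_nonneg _).trans hta
  set E := Real.exp (Real.pi * b * |z.im|)
  set Λ := max (Real.log ‖z‖) 0
  have hΛ₀ : 0 ≤ Λ := le_max_right _ _
  have hS' : ‖ta * (S z / S xt)‖ ≤ A * (C * E / ‖S xt‖ * (1 + Λ)) := by
    rw [norm_mul, norm_div]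
    refine mul_le_mul hta ?_ (by positivity) hA
    refine le_trans ?_ (le_mul_of_one_le_right (by positivity) (by linarith))
    gcongr
    exact hC z
  have hsum (s : Finset ℤ) :
      ∑ k ∈ s, ‖a k * interpKernel x S xt k z‖ ≤ A * (D * E * (1 + Λ)) := by
    refine le_trans ?_ (mul_le_mul_of_nonneg_left (hD s z) hA)
    rw [Finset.mul_sum]
    gcongr with k
    rw [norm_mul]
    gcongr
    exact ha k
  have hsummable := summable_of_sum_le (fun k => norm_nonneg _) hsum
  calc ‖interpolant x S xt ta a z‖
      ≤ ‖ta * (S z / S xt)‖ + ‖∑' k, a k * interpKernel x S xt k z‖ := norm_add_le _ _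
    _ ≤ A * (C * E / ‖S xt‖ * (1 + Λ)) + A * (D * E * (1 + Λ)) :=
        add_le_add hS' ((norm_tsum_le_tsum_norm hsummable).trans
          (hsummable.tsum_le_of_sum_le hsum))
    _ = (C / ‖S xt‖ + D) * A * E * (1 + Λ) := by ring

lemma mem_PWPlus_of_norm_le {f : ℂ → ℂ} {D : ℝ} (hf : Differentiable ℂ f)
    (hD : ∀ z : ℂ, ‖f z‖ ≤
      D * Real.exp (Real.pi * b * |z.im|) * (1 + max (Real.log ‖z‖) 0)) : f ∈ PWPlus b := by
  refine ⟨hf, ?_⟩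
  have hlim : Tendsto (fun r : ℝ => D * (r⁻¹ + Real.log r / r) * |2 * Real.pi - 0|) atTop
      (𝓝 0) := by
    have hlog : Tendsto (fun r : ℝ => Real.log r / r) atTop (𝓝 0) :=
      Real.isLittleO_log_id_atTop.tendsto_div_nhds_zero
    simpa using ((tendsto_inv_atTop_zero.add hlog).const_mul D).mul_const |2 * Real.pi - 0|
  refine squeeze_zero_norm' ?_ hlim
  filter_upwards [eventually_ge_atTop 1] with r hr
  have hr₀ : 0 < r := by linarith
  refine intervalIntegral.norm_integral_le_of_norm_le_const fun θ _ => ?_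
  set z := circleMap 0 r θ
  have hzr : ‖z‖ = r := by rw [norm_circleMap_zero, abs_of_pos hr₀]
  have hfz := hD z
  rw [hzr, max_eq_left (Real.log_nonneg hr)] at hfz
  rw [Real.norm_of_nonneg (by positivity), hzr]
  calc (r ^ 2)⁻¹ * Real.exp (-(Real.pi * b * |z.im|)) * ‖f z‖ * r
      ≤ (r ^ 2)⁻¹ * Real.exp (-(Real.pi * b * |z.im|)) *
          (D * Real.exp (Real.pi * b * |z.im|) * (1 + Real.log r)) * r := by gcongr
    _ = D * (r⁻¹ + Real.log r / r) := by
        rw [Real.exp_neg]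
        field_simp

end Interpolant

/-! ### Convergence of the interpolation series -/

/-- The circle of radius `ρ` about `0` avoids the zeros of `S` quantitatively: `S` has there the
full size `exp (π b |Im ζ|)`, up to the constant `c`. -/
structure IsGoodRadius (S : ℂ → ℂ) (b c ρ : ℝ) : Prop where
  pos : 0 < ρ
  const_pos : 0 < c
  le_norm : ∀ ζ ∈ Metric.sphere 0 ρ, c * Real.exp (Real.pi * b * |ζ.im|) ≤ ‖S ζ‖

lemma circleGrowth_nonneg (b : ℝ) (f : ℂ → ℂ) {ρ : ℝ} (hρ : 0 ≤ ρ) : 0 ≤ circleGrowth b f ρ :=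
  intervalIntegral.integral_nonneg Real.two_pi_pos.le fun _ _ => by positivity

lemma IsGoodRadius.norm_circleIntegral_le {S f w : ℂ → ℂ} {b c ρ M : ℝ}
    (h : IsGoodRadius S b c ρ) (hf : Continuous f) (hw : ∀ ζ ∈ Metric.sphere 0 ρ, ‖w ζ‖ ≤ M) :
    ‖∮ ζ in C(0, ρ), f ζ / S ζ * w ζ‖ ≤ M * ρ ^ 2 / c * circleGrowth b f ρ := by
  obtain ⟨hρ, hc, hS⟩ := h
  have hcont : Continuous fun θ => M * ρ ^ 2 / c * ((‖circleMap 0 ρ θ‖ ^ 2)⁻¹ *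
      Real.exp (-(Real.pi * b * |(circleMap 0 ρ θ).im|)) * ‖f (circleMap 0 ρ θ)‖ * ρ) := by
    simp only [norm_circleMap_zero]
    fun_prop
  rw [circleIntegral, circleGrowth, ← intervalIntegral.integral_const_mul]
  refine intervalIntegral.norm_integral_le_of_norm_le Real.two_pi_pos.le
    (MeasureTheory.ae_of_all _ fun θ _ => ?_) (hcont.intervalIntegrable _ _)
  set ζ := circleMap 0 ρ θ
  have hζ : ‖ζ‖ = ρ := by rw [norm_circleMap_zero, abs_of_pos hρ]
  have hsphere : ζ ∈ Metric.sphere 0 ρ := mem_sphere_zero_iff_norm.2 hζ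
  have hquot : ‖f ζ / S ζ‖ ≤ ‖f ζ‖ / (c * Real.exp (Real.pi * b * |ζ.im|)) := by
    rw [norm_div]
    gcongr
    exact hS ζ hsphere
  rw [deriv_circleMap, norm_smul, norm_mul, Complex.norm_I, mul_one, hζ, norm_mul]
  calc ρ * (‖f ζ / S ζ‖ * ‖w ζ‖)
      ≤ ρ * (‖f ζ‖ / (c * Real.exp (Real.pi * b * |ζ.im|)) * M) := by
        gcongr
        exact hw ζ hsphere
    _ = M * ρ ^ 2 / c * ((ρ ^ 2)⁻¹ * Real.exp (-(Real.pi * b * |ζ.im|)) * ‖f ζ‖ * ρ) := by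
        rw [Real.exp_neg]
        field_simp

namespace IsSeparatedBy

variable {ι : Type*} {l : ℝ} {x : ι → ℝ} (hx : IsSeparatedBy l x)
include hx

lemma eq_of_abs_abs_sub_abs_lt {j k : ι} (hsign : 0 ≤ x j ↔ 0 ≤ x k)
    (hlt : |(|x j| - |x k|)| < l) : j = k := by
  by_contra hne
  have hsep : l ≤ |x j - x k| := hx.le_abs_sub hne
  rcases le_or_gt 0 (x j) with hj | hj
  · rw [abs_of_nonneg hj, abs_of_nonneg (hsign.1 hj)] at hlt
    exact hsep.not_gt hlt
  · have hk : x k < 0 := not_le.1 fun hk => hj.not_ge (hsign.2 hk)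
    rw [abs_of_neg hj, abs_of_neg hk, neg_sub_neg, abs_sub_comm] at hlt
    exact hsep.not_gt hlt

lemma abs_sub_eq_abs_add_abs {j k : ι} (hjk : j ≠ k) (hlt : |(|x j| - |x k|)| < l) :
    |x j - x k| = |x j| + |x k| := by
  rcases le_or_gt 0 (x j) with hj | hj <;> rcases le_or_gt 0 (x k) with hk | hk
  · exact absurd (hx.eq_of_abs_abs_sub_abs_lt (iff_of_true hj hk) hlt) hjk
  · rw [abs_of_nonneg hj, abs_of_neg hk, abs_of_nonneg (by linarith), sub_eq_add_neg]
  · rw [abs_of_neg hj, abs_of_nonneg hk, abs_of_nonpos (by linarith)]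
    ring
  · exact absurd (hx.eq_of_abs_abs_sub_abs_lt (iff_of_false hj.not_ge hk.not_ge) hlt) hjk

lemma card_le_two {A : Finset ι} (hA : ∀ j ∈ A, ∀ k ∈ A, |(|x j| - |x k|)| < l) : A.card ≤ 2 := by
  calc A.card ≤ (Finset.univ : Finset Prop).card :=
        Finset.card_le_card_of_injOn (fun k => 0 ≤ x k)
          (fun _ _ => Finset.mem_coe.2 (Finset.mem_univ _))
          fun j hj k hk h => hx.eq_of_abs_abs_sub_abs_lt (Iff.of_eq h) (hA j hj k hk)
    _ = 2 := rfl

/-- One of the radii `r`, `r + l / 8`, `r + l / 4` works, since at most two points have modulus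
near this range. -/
lemma exists_forall_mem_sphere_le_norm_sub (r : ℝ) :
    ∃ ρ ∈ Set.Icc r (r + l / 4), ∀ ζ ∈ Metric.sphere (0 : ℂ) ρ, ∀ k, l / 16 ≤ ‖ζ - x k‖ := by
  by_contra! hbad
  have hpos := hx.pos
  have hnear (i : Fin 3) : ∃ k, |(|x k| - (r + i * (l / 8)))| < l / 16 := by
    have hi : (i : ℝ) ≤ 2 := by exact_mod_cast Nat.le_of_lt_succ i.isLt
    obtain ⟨ζ, hζ, k, hk⟩ := hbad (r + i * (l / 8))
      ⟨le_add_of_nonneg_right (by positivity), by nlinarith⟩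
    refine ⟨k, lt_of_le_of_lt ?_ hk⟩
    rw [← mem_sphere_zero_iff_norm.1 hζ, abs_sub_comm, ← Real.norm_eq_abs (x k),
      ← Complex.norm_real]
    exact abs_norm_sub_norm_le _ _
  choose k hk using hnear
  have hk_inj : Function.Injective k := fun i j hij => by
    have hi := abs_lt.1 (hk i)
    have hj := abs_lt.1 (hk j)
    rw [hij] at hi
    have h₁ : (i : ℝ) < j + 1 := by nlinarith
    have h₂ : (j : ℝ) < i + 1 := by nlinarith
    norm_cast at h₁ h₂
    omega
  have hcard := hx.card_le_two (A := Finset.univ.map ⟨k, hk_inj⟩) fun i hi j hj => by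
    simp only [Finset.mem_map, Finset.mem_univ, true_and, Function.Embedding.coeFn_mk] at hi hj
    obtain ⟨⟨i, rfl⟩, j, rfl⟩ := And.intro hi hj
    have hi₂ : (i : ℝ) ≤ 2 := by exact_mod_cast Nat.le_of_lt_succ i.isLt
    have hj₂ : (j : ℝ) ≤ 2 := by exact_mod_cast Nat.le_of_lt_succ j.isLt
    have hi := abs_lt.1 (hk i)
    have hj := abs_lt.1 (hk j)
    rw [abs_lt]
    constructor <;> nlinarith
  simp at hcard

/-- The indices `k` with `ρ₁ ≤ |x k| < ρ₂`. -/
noncomputable def annulus (ρ₁ ρ₂ : ℝ) : Finset ι :=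
  {k ∈ (hx.finite_abs_lt ρ₂).toFinset | ρ₁ ≤ |x k|}

variable {ρ₁ ρ₂ : ℝ} {j k : ι}

lemma mem_annulus : k ∈ hx.annulus ρ₁ ρ₂ ↔ ρ₁ ≤ |x k| ∧ |x k| < ρ₂ := by
  simp only [annulus, Finset.mem_filter, Set.Finite.mem_toFinset, Set.mem_ofPred_eq, and_comm]

lemma sum_abs_lt_add_sum_annulus {M : Type*} [AddCommMonoid M] (hρ : ρ₁ ≤ ρ₂) (g : ι → M) :
    ∑ k ∈ (hx.finite_abs_lt ρ₁).toFinset, g k + ∑ k ∈ hx.annulus ρ₁ ρ₂, g k =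
      ∑ k ∈ (hx.finite_abs_lt ρ₂).toFinset, g k := by
  have hN₁ : (hx.finite_abs_lt ρ₁).toFinset =
      {k ∈ (hx.finite_abs_lt ρ₂).toFinset | ¬ρ₁ ≤ |x k|} := by
    ext k
    simp only [Set.Finite.mem_toFinset, Set.mem_ofPred_eq, Finset.mem_filter, not_le]
    exact ⟨fun h => ⟨h.trans_le hρ, h⟩, And.right⟩
  rw [hN₁, annulus, add_comm, Finset.sum_filter_add_sum_filter_not]

lemma abs_abs_sub_abs_lt_of_mem_annulus (hρ : ρ₂ - ρ₁ < l) (hj : j ∈ hx.annulus ρ₁ ρ₂)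
    (hk : k ∈ hx.annulus ρ₁ ρ₂) : |(|x j| - |x k|)| < l := by
  rw [mem_annulus] at hj hk
  rw [abs_lt]
  constructor <;> linarith

lemma card_annulus_le_two (hρ : ρ₂ - ρ₁ < l) : (hx.annulus ρ₁ ρ₂).card ≤ 2 :=
  hx.card_le_two fun _ hj _ hk => hx.abs_abs_sub_abs_lt_of_mem_annulus hρ hj hk

/-- The Lagrange basis polynomial `∏ (ζ - x j) / (x k - x j)` over the other points of the annulus.
There is at most one such point, and it lies on the opposite half-line. -/
lemma exists_weight (hpos : 0 < ρ₁) (hρ : ρ₂ - ρ₁ < l) (htwo : ρ₂ ≤ 2 * ρ₁)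
    (hk : k ∈ hx.annulus ρ₁ ρ₂) :
    ∃ w : ℂ → ℂ, Differentiable ℂ w ∧ w (x k) = 1 ∧
      (∀ j ∈ hx.annulus ρ₁ ρ₂, j ≠ k → w (x j) = 0) ∧ ∀ ζ, ‖ζ‖ ≤ ρ₂ → ‖w ζ‖ ≤ 2 := by
  classical
  set A := hx.annulus ρ₁ ρ₂
  have hfactor {ζ : ℂ} (hζ : ‖ζ‖ ≤ ρ₂) : ∀ j ∈ A.erase k, ‖(ζ - x j) / (x k - x j)‖ ≤ 2 :=
    fun j hj => by
      obtain ⟨hjk, hjA⟩ := Finset.mem_erase.1 hj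
      have hj₁ := (hx.mem_annulus.1 hjA).1
      have hk₁ := (hx.mem_annulus.1 hk).1
      have hnum : ‖ζ - x j‖ ≤ ‖ζ‖ + |x j| := by simpa using norm_sub_le ζ (x j)
      rw [norm_div, ← Complex.ofReal_sub, Complex.norm_real, Real.norm_eq_abs,
        hx.abs_sub_eq_abs_add_abs hjk.symm (hx.abs_abs_sub_abs_lt_of_mem_annulus hρ hk hjA),
        div_le_iff₀ (by linarith)]
      linarith
  have hcard : (A.erase k).card ≤ 1 := by
    rw [Finset.card_erase_of_mem hk]
    exact Nat.sub_le_of_le_add (hx.card_annulus_le_two hρ)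
  refine ⟨fun ζ => ∏ j ∈ A.erase k, (ζ - x j) / (x k - x j), by fun_prop,
    Finset.prod_eq_one fun j hj => div_self <| sub_ne_zero.2 fun h =>
      Finset.ne_of_mem_erase hj (hx.injective (Complex.ofReal_injective h)).symm,
    fun j hj hjk => Finset.prod_eq_zero (Finset.mem_erase.2 ⟨hjk, hj⟩) (by rw [sub_self, zero_div]),
    fun ζ hζ => ?_⟩
  calc ‖∏ j ∈ A.erase k, (ζ - x j) / (x k - x j)‖
      = ∏ j ∈ A.erase k, ‖(ζ - x j) / (x k - x j)‖ := norm_prod _ _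
    _ ≤ 2 ^ (A.erase k).card :=
        (Finset.prod_le_prod (fun _ _ => norm_nonneg _) (hfactor hζ)).trans_eq
          (Finset.prod_const _)
    _ ≤ 2 := (pow_le_pow_right₀ one_le_two hcard).trans_eq (pow_one 2)

end IsSeparatedBy

lemma one_le_norm_two_pi_I : 1 ≤ ‖(2 * Real.pi * Complex.I : ℂ)‖ := by
  simp only [norm_mul, Complex.norm_ofNat, Complex.norm_real, Complex.norm_I, mul_one,
    Real.norm_of_nonneg Real.pi_pos.le]
  linarith [Real.pi_gt_three]

namespace IsSineType

section Nodes

variable {ι : Type*} {x : ι → ℝ} {S f : ℂ → ℂ} {b l c ρ ρ₁ ρ₂ : ℝ} (hS : IsSineType x S b)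
  (hx : IsSeparatedBy l x)
include hS hx

lemma exists_isGoodRadius :
    ∃ c, ∀ r > 0, ∃ ρ ∈ Set.Icc r (r + l / 4), IsGoodRadius S b c ρ := by
  obtain ⟨c, hc, hcS⟩ := hS.exists_le_norm (l / 16) (div_pos hx.pos (by norm_num))
  refine ⟨c, fun r hr => ?_⟩
  obtain ⟨ρ, hρ, hfar⟩ := hx.exists_forall_mem_sphere_le_norm_sub r
  exact ⟨ρ, hρ, hr.trans_le hρ.1, hc, fun ζ hζ => hcS ζ (hfar ζ hζ)⟩

lemma exists_isGoodRadius_tendsto :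
    ∃ (c : ℝ) (ρ₁ ρ₂ : ℝ → ℝ), Tendsto ρ₁ atTop atTop ∧ Tendsto ρ₂ atTop atTop ∧
      ∀ᶠ r in atTop, IsGoodRadius S b c (ρ₁ r) ∧ IsGoodRadius S b c (ρ₂ r) ∧
        r ∈ Set.Icc (ρ₁ r) (ρ₂ r) ∧ ρ₂ r - ρ₁ r < l := by
  have hpos := hx.pos
  obtain ⟨c, hc⟩ := hS.exists_isGoodRadius hx
  choose! ρ hρ hgood using hc
  have hρ_atTop : Tendsto ρ atTop atTop :=
    tendsto_atTop_mono' _ ((eventually_gt_atTop 0).mono fun r hr => (hρ r hr).1) tendsto_id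
  refine ⟨c, fun r => ρ (r - l / 4), ρ,
    hρ_atTop.comp (tendsto_atTop_add_const_right _ _ tendsto_id), hρ_atTop, ?_⟩
  filter_upwards [eventually_gt_atTop l] with r hr
  have h₁ : 0 < r - l / 4 := by linarith
  have h₂ : 0 < r := hpos.trans hr
  obtain ⟨hρ₁, hρ₁'⟩ := hρ _ h₁
  obtain ⟨hρ₂, hρ₂'⟩ := hρ _ h₂
  exact ⟨hgood _ h₁, hgood _ h₂, ⟨by linarith, hρ₂⟩, by linarith⟩

lemma hasSimpleZerosInBall (hρ : IsGoodRadius S b c ρ) :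
    HasSimpleZerosInBall S (fun k => (x k : ℂ)) (hx.finite_abs_lt ρ).toFinset 0 ρ where
  injOn := (Complex.ofReal_injective.comp hx.injective).injOn
  mem_ball k hk := by
    rw [mem_ball_zero_iff, Complex.norm_real, Real.norm_eq_abs]
    exact ((hx.finite_abs_lt ρ).mem_toFinset (a := k)).1 hk
  apply_eq_zero k _ := hS.apply_eq_zero k
  deriv_ne_zero k _ := hS.deriv_ne_zero k
  exists_eq z hz hz₀ := by
    have hlt : ‖z‖ < ρ := lt_of_le_of_ne (mem_closedBall_zero_iff.1 hz) fun h => by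
      have hle := hρ.le_norm z (mem_sphere_zero_iff_norm.2 h)
      rw [hz₀, norm_zero] at hle
      exact hle.not_gt (mul_pos hρ.const_pos (Real.exp_pos _))
    obtain ⟨k, rfl⟩ := hS.exists_eq_of_apply_eq_zero hx hz₀
    rw [Complex.norm_real, Real.norm_eq_abs] at hlt
    exact ⟨k, (hx.finite_abs_lt ρ).mem_toFinset.2 hlt, rfl⟩

lemma sum_annulus_div_deriv_eq (hf : Differentiable ℂ f) (h₁ : IsGoodRadius S b c ρ₁)
    (h₂ : IsGoodRadius S b c ρ₂) (hle : ρ₁ ≤ ρ₂) :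
    2 * Real.pi * Complex.I * ∑ k ∈ hx.annulus ρ₁ ρ₂, f (x k) / deriv S (x k) =
      (∮ ζ in C(0, ρ₂), f ζ / S ζ) - ∮ ζ in C(0, ρ₁), f ζ / S ζ := by
  rw [circleIntegral_div_eq_sum h₂.pos.le hS.differentiable hf (hS.hasSimpleZerosInBall hx h₂),
    circleIntegral_div_eq_sum h₁.pos.le hS.differentiable hf (hS.hasSimpleZerosInBall hx h₁),
    ← hx.sum_abs_lt_add_sum_annulus hle, mul_add, add_sub_cancel_left]

lemma norm_div_deriv_le (hf : Differentiable ℂ f) (h₁ : IsGoodRadius S b c ρ₁)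
    (h₂ : IsGoodRadius S b c ρ₂) (hρ : ρ₂ - ρ₁ < l) (htwo : ρ₂ ≤ 2 * ρ₁) {k : ι}
    (hk : k ∈ hx.annulus ρ₁ ρ₂) :
    ‖f (x k) / deriv S (x k)‖ ≤
      8 * ρ₁ ^ 2 / c * (circleGrowth b f ρ₁ + circleGrowth b f ρ₂) := by
  have hpos₂ := h₂.pos
  have hc := h₁.const_pos
  have hle : ρ₁ ≤ ρ₂ := by linarith [hx.mem_annulus.1 hk]
  have hgrowth := circleGrowth_nonneg b f h₁.pos.le
  have hgrowth₂ := circleGrowth_nonneg b f h₂.pos.le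
  obtain ⟨w, hw, hw_self, hw_ne, hw_le⟩ := hx.exists_weight h₁.pos hρ htwo hk
  have hresidue : 2 * Real.pi * Complex.I * (f (x k) / deriv S (x k)) =
      (∮ ζ in C(0, ρ₂), f ζ / S ζ * w ζ) - ∮ ζ in C(0, ρ₁), f ζ / S ζ * w ζ := by
    have hsum := hS.sum_annulus_div_deriv_eq hx (hf.fun_mul hw) h₁ h₂ hle
    rw [Finset.sum_eq_single_of_mem k hk fun j hj hjk => by
      rw [hw_ne j hj hjk, mul_zero, zero_div], hw_self, mul_one] at hsum
    simpa only [mul_div_right_comm] using hsum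
  have hbound {ρ : ℝ} (hg : IsGoodRadius S b c ρ) (hρ : ρ ≤ ρ₂) :
      ‖∮ ζ in C(0, ρ), f ζ / S ζ * w ζ‖ ≤ 2 * ρ ^ 2 / c * circleGrowth b f ρ :=
    hg.norm_circleIntegral_le hf.continuous fun ζ hζ =>
      hw_le ζ ((mem_sphere_zero_iff_norm.1 hζ).trans_le hρ)
  calc ‖f (x k) / deriv S (x k)‖
      ≤ ‖2 * Real.pi * Complex.I * (f (x k) / deriv S (x k))‖ := by
        rw [norm_mul]
        exact le_mul_of_one_le_left (norm_nonneg _) one_le_norm_two_pi_I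
    _ ≤ 2 * ρ₂ ^ 2 / c * circleGrowth b f ρ₂ + 2 * ρ₁ ^ 2 / c * circleGrowth b f ρ₁ := by
        rw [hresidue]
        exact (norm_sub_le _ _).trans (add_le_add (hbound h₂ le_rfl) (hbound h₁ hle))
    _ ≤ 2 * (2 * ρ₁) ^ 2 / c * circleGrowth b f ρ₂ +
          2 * (2 * ρ₁) ^ 2 / c * circleGrowth b f ρ₁ := by
        gcongr <;> linarith [h₁.pos]
    _ = 8 * ρ₁ ^ 2 / c * (circleGrowth b f ρ₁ + circleGrowth b f ρ₂) := by ring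

end Nodes

section Interpolation

variable {x : ℤ → ℝ} {S f : ℂ → ℂ} {b l c r ρ ρ₁ ρ₂ : ℝ} {xt z : ℂ} (hS : IsSineType x S b)
  (hx : IsSeparatedBy l x) (hxt : xt ∉ pointSet x) (hf : Differentiable ℂ f)
include hS hx hxt hf

lemma sub_interpPartialSum_eq (hρ : IsGoodRadius S b c ρ) (hz : ‖z‖ < ρ) (hxtρ : ‖xt‖ < ρ) :
    f z - interpPartialSum x S xt (f xt) (fun k => f (x k)) {k | |x k| < ρ} z =
      S z * ((2 * Real.pi * Complex.I)⁻¹ *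
        ∮ ζ in C(0, ρ), f ζ / S ζ * ((ζ - z)⁻¹ - (ζ - xt)⁻¹)) := by
  have hzeros := hS.hasSimpleZerosInBall hx hρ
  have hSxt := hS.apply_ne_zero hx hxt
  have hint {w : ℂ} (hw : ‖w‖ < ρ) : CircleIntegrable (fun ζ => f ζ / S ζ * (ζ - w)⁻¹) 0 ρ :=
    ((hf.continuous.continuousOn.div hS.differentiable.continuous.continuousOn
      fun ζ hζ => hzeros.ne_zero_of_mem_sphere hζ).mul (ContinuousOn.inv₀ (by fun_prop)
        fun ζ hζ => sub_ne_zero.2 (Metric.sphere_disjoint_ball.ne_of_mem hζ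
          (mem_ball_zero_iff.2 hw)))).circleIntegrable hρ.pos.le
  have hLz := sub_sum_mul_lagrangeKernel_eq hS.differentiable hf hzeros (mem_ball_zero_iff.2 hz)
  have hLxt := sub_sum_mul_lagrangeKernel_eq hS.differentiable hf hzeros
    (mem_ball_zero_iff.2 hxtρ)
  simp only [mul_sub]
  rw [circleIntegral.integral_sub (hint hz) (hint hxtρ), mul_sub, mul_sub, ← hLz,
    interpPartialSum, finsum_mem_eq_finite_toFinset_sum _ (hx.finite_abs_lt ρ)]
  simp only [interpKernel_eq_sub hS.differentiable (hS.apply_eq_zero _) hSxt, mul_sub,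
    mul_left_comm _ (S z / S xt), Finset.sum_sub_distrib, ← Finset.mul_sum]
  linear_combination (norm := (field_simp; ring)) (S z / S xt) * -hLxt

lemma norm_sub_interpPartialSum_le (hρ : IsGoodRadius S b c ρ) (hz : 2 * ‖z‖ ≤ ρ)
    (hxtρ : 2 * ‖xt‖ ≤ ρ) :
    ‖f z - interpPartialSum x S xt (f xt) (fun k => f (x k)) {k | |x k| < ρ} z‖ ≤
      4 / c * (‖S z‖ * ‖z - xt‖) * circleGrowth b f ρ := by
  have hpos := hρ.pos
  have hfar {w ζ : ℂ} (hw : 2 * ‖w‖ ≤ ρ) (hζ : ζ ∈ Metric.sphere 0 ρ) : ρ / 2 ≤ ‖ζ - w‖ := by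
    have := norm_sub_norm_le ζ w
    rw [mem_sphere_zero_iff_norm.1 hζ] at this
    linarith
  have hweight : ∀ ζ ∈ Metric.sphere (0 : ℂ) ρ,
      ‖(ζ - z)⁻¹ - (ζ - xt)⁻¹‖ ≤ ‖z - xt‖ / (ρ / 2 * (ρ / 2)) := fun ζ hζ => by
    have hζz := hfar hz hζ
    have hζxt := hfar hxtρ hζ
    rw [inv_sub_inv (norm_pos_iff.1 (by linarith)) (norm_pos_iff.1 (by linarith)), norm_div,
      norm_mul, sub_sub_sub_cancel_left]
    gcongr
  have hpi : ‖(2 * Real.pi * Complex.I)⁻¹‖ ≤ 1 := by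
    rw [norm_inv]
    exact inv_le_one_of_one_le₀ one_le_norm_two_pi_I
  rw [hS.sub_interpPartialSum_eq hx hxt hf hρ (by linarith [norm_nonneg z])
    (by linarith [norm_nonneg xt]), norm_mul, norm_mul]
  calc ‖S z‖ * (‖(2 * Real.pi * Complex.I)⁻¹‖ *
        ‖∮ ζ in C(0, ρ), f ζ / S ζ * ((ζ - z)⁻¹ - (ζ - xt)⁻¹)‖)
      ≤ ‖S z‖ * (1 * (‖z - xt‖ / (ρ / 2 * (ρ / 2)) * ρ ^ 2 / c * circleGrowth b f ρ)) := by
        gcongr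
        exact hρ.norm_circleIntegral_le hf.continuous hweight
    _ = 4 / c * (‖S z‖ * ‖z - xt‖) * circleGrowth b f ρ := by
        field_simp
        ring

lemma norm_mul_interpKernel_le (h₁ : IsGoodRadius S b c ρ₁) (h₂ : IsGoodRadius S b c ρ₂)
    (hρ : ρ₂ - ρ₁ < l) (htwo : ρ₂ ≤ 2 * ρ₁) (hz : 2 * ‖z‖ ≤ ρ₁) (hxtρ : 2 * ‖xt‖ ≤ ρ₁) {k : ℤ}
    (hk : k ∈ hx.annulus ρ₁ ρ₂) :
    ‖f (x k) * interpKernel x S xt k z‖ ≤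
      32 / c * (‖S z‖ * ‖z - xt‖) * (circleGrowth b f ρ₁ + circleGrowth b f ρ₂) := by
  have hpos := h₁.pos
  have hc := h₁.const_pos
  have hk₁ := (hx.mem_annulus.1 hk).1
  have hfar {w : ℂ} (hw : 2 * ‖w‖ ≤ ρ₁) : ρ₁ / 2 ≤ ‖w - x k‖ := by
    have := norm_sub_norm_le (x k : ℂ) w
    rw [Complex.norm_real, Real.norm_eq_abs, norm_sub_rev] at this
    linarith
  have hzk := hfar hz
  have hxtk := hfar hxtρ
  have heq : f (x k) * interpKernel x S xt k z =
      f (x k) / deriv S (x k) * (S z / (z - x k) * ((xt - z) / (xt - x k))) := by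
    rw [interpKernel_eq hS.differentiable (hS.apply_eq_zero k)
      (ne_ofReal_of_notMem_pointSet hxt k), lagrangeKernel, dslope_of_ne_of_eq_zero
      (hS.apply_eq_zero k) (sub_ne_zero.1 (norm_pos_iff.1 (by linarith)))]
    ring
  have hgrowth : 0 ≤ circleGrowth b f ρ₁ + circleGrowth b f ρ₂ :=
    add_nonneg (circleGrowth_nonneg b f hpos.le) (circleGrowth_nonneg b f h₂.pos.le)
  rw [heq, norm_mul, norm_mul, norm_div (S z), norm_div (xt - z), norm_sub_rev xt z]
  calc ‖f (x k) / deriv S (x k)‖ * (‖S z‖ / ‖z - x k‖ * (‖z - xt‖ / ‖xt - x k‖))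
      ≤ 8 * ρ₁ ^ 2 / c * (circleGrowth b f ρ₁ + circleGrowth b f ρ₂) *
          (‖S z‖ / (ρ₁ / 2) * (‖z - xt‖ / (ρ₁ / 2))) := by
        gcongr
        exact hS.norm_div_deriv_le hx hf h₁ h₂ hρ htwo hk
    _ = _ := by
        field_simp
        ring

lemma norm_sub_interpPartialSum_le_add (h₁ : IsGoodRadius S b c ρ₁) (h₂ : IsGoodRadius S b c ρ₂)
    (hρ : ρ₂ - ρ₁ < l) (htwo : ρ₂ ≤ 2 * ρ₁) (hz : 2 * ‖z‖ ≤ ρ₁) (hxtρ : 2 * ‖xt‖ ≤ ρ₁)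
    (hr : r ∈ Set.Icc ρ₁ ρ₂) :
    ‖f z - interpPartialSum x S xt (f xt) (fun k => f (x k)) {k | |x k| < r} z‖ ≤
      68 / c * (‖S z‖ * ‖z - xt‖) * (circleGrowth b f ρ₁ + circleGrowth b f ρ₂) := by
  set M := ‖S z‖ * ‖z - xt‖
  set G := circleGrowth b f ρ₁ + circleGrowth b f ρ₂
  have hc := h₁.const_pos
  have hsplit : interpPartialSum x S xt (f xt) (fun k => f (x k)) {k | |x k| < r} z =
      interpPartialSum x S xt (f xt) (fun k => f (x k)) {k | |x k| < ρ₁} z +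
        ∑ k ∈ hx.annulus ρ₁ r, f (x k) * interpKernel x S xt k z := by
    rw [interpPartialSum, interpPartialSum,
      finsum_mem_eq_finite_toFinset_sum _ (hx.finite_abs_lt r),
      finsum_mem_eq_finite_toFinset_sum _ (hx.finite_abs_lt ρ₁),
      ← hx.sum_abs_lt_add_sum_annulus hr.1, add_assoc]
  have hmem : ∀ k ∈ hx.annulus ρ₁ r, k ∈ hx.annulus ρ₁ ρ₂ := fun k hk => by
    rw [hx.mem_annulus] at hk ⊢
    exact ⟨hk.1, hk.2.trans_le hr.2⟩
  have hG₁ : circleGrowth b f ρ₁ ≤ G :=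
    le_add_of_nonneg_right (circleGrowth_nonneg b f h₂.pos.le)
  have hG₀ : 0 ≤ G := (circleGrowth_nonneg b f h₁.pos.le).trans hG₁
  rw [hsplit, ← sub_sub]
  calc _ ≤ 4 / c * M * circleGrowth b f ρ₁ +
        (hx.annulus ρ₁ r).card * (32 / c * M * G) := by
        refine (norm_sub_le _ _).trans
          (add_le_add (hS.norm_sub_interpPartialSum_le hx hxt hf h₁ hz hxtρ) ?_)
        rw [← nsmul_eq_mul, ← Finset.sum_const]
        exact norm_sum_le_of_le _ fun k hk =>
          hS.norm_mul_interpKernel_le hx hxt hf h₁ h₂ hρ htwo hz hxtρ (hmem k hk)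
    _ ≤ 4 / c * M * G + 2 * (32 / c * M * G) := by
        gcongr
        exact_mod_cast hx.card_annulus_le_two (by linarith [hr.2])
    _ = 68 / c * M * G := by ring

lemma tendstoUniformlyOn_interpPartialSum (hgrowth : Tendsto (circleGrowth b f) atTop (𝓝 0))
    {K : Set ℂ} (hK : IsCompact K) :
    TendstoUniformlyOn
      (fun r z => interpPartialSum x S xt (f xt) (fun k => f (x k)) {k | |x k| < r} z)
      f atTop K := by
  obtain ⟨c, ρ₁, ρ₂, hρ₁, hρ₂, hgood⟩ := hS.exists_isGoodRadius_tendsto hx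
  obtain ⟨M, hM⟩ : ∃ M, ∀ z ∈ K, ‖‖S z‖ * ‖z - xt‖‖ ≤ M := by
    refine hK.exists_bound_of_continuousOn (Continuous.continuousOn ?_)
    exact hS.differentiable.continuous.norm.mul (by fun_prop)
  obtain ⟨R, hR⟩ := hK.isBounded.exists_norm_le
  have hG : Tendsto (fun r => 68 / c * M *
      (circleGrowth b f (ρ₁ r) + circleGrowth b f (ρ₂ r))) atTop (𝓝 0) := by
    simpa using ((hgrowth.comp hρ₁).add (hgrowth.comp hρ₂)).const_mul (68 / c * M)
  rw [Metric.tendstoUniformlyOn_iff]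
  intro ε hε
  filter_upwards [hgood, hG.eventually_lt_const hε, hρ₁.eventually_ge_atTop l,
    hρ₁.eventually_ge_atTop (2 * R), hρ₁.eventually_ge_atTop (2 * ‖xt‖)]
    with r ⟨h₁, h₂, hr, hρ⟩ hGr hlr hRr hxtr z hz
  have hc := h₁.const_pos
  have hgrowth₁ := circleGrowth_nonneg b f h₁.pos.le
  have hgrowth₂ := circleGrowth_nonneg b f h₂.pos.le
  rw [dist_eq_norm]
  calc _ ≤ 68 / c * (‖S z‖ * ‖z - xt‖) * (circleGrowth b f (ρ₁ r) + circleGrowth b f (ρ₂ r)) :=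
        hS.norm_sub_interpPartialSum_le_add hx hxt hf h₁ h₂ hρ (by linarith)
          (by linarith [hR z hz]) hxtr hr
    _ ≤ 68 / c * M * (circleGrowth b f (ρ₁ r) + circleGrowth b f (ρ₂ r)) := by
        gcongr
        exact (le_abs_self _).trans (hM z hz)
    _ < ε := hGr

end Interpolation

end IsSineType

/-! ### Generating functions -/

lemma IsSeparatedSeq.isSeparatedBy {x : ℤ → ℝ} (hx : IsSeparatedSeq x) :
    IsSeparatedBy (separationConstant x) x := by
  have hlt {j k : ℤ} (hjk : j < k) : separationConstant x ≤ |x j - x k| :=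
    calc separationConstant x ≤ |x (j + 1) - x j| :=
          ciInf_le ⟨0, by rintro _ ⟨i, rfl⟩; exact abs_nonneg _⟩ j
      _ = x (j + 1) - x j := abs_of_pos (sub_pos.2 (hx.strictMono (lt_add_one j)))
      _ ≤ x k - x j := by
          gcongr
          exact hx.strictMono.monotone (Int.add_one_le_iff.2 hjk)
      _ ≤ |x j - x k| := by
          rw [abs_sub_comm]
          exact le_abs_self _
  refine ⟨hx.separationConstant_pos, fun j k hjk => ?_⟩
  rcases hjk.lt_or_gt with h | h
  · exact hlt h
  · rw [abs_sub_comm]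
    exact hlt h

lemma norm_ofReal_add_I_le {d : ℝ} (hd : d ≠ 0) :
    ‖(d + Complex.I : ℂ)‖ ≤ |d| * Real.exp (d ^ 2)⁻¹ := by
  have hnorm : ‖(d + Complex.I : ℂ)‖ ^ 2 = d ^ 2 + 1 := by
    rw [Complex.sq_norm, Complex.normSq_apply]
    simp
    ring
  refine abs_le_of_sq_le_sq' ?_ (by positivity) |>.2
  calc ‖(d + Complex.I : ℂ)‖ ^ 2 = d ^ 2 * ((d ^ 2)⁻¹ + 1) := by rw [hnorm]; field_simp; ring
    _ ≤ d ^ 2 * (Real.exp (d ^ 2)⁻¹) ^ 2 := by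
        gcongr
        have := Real.add_one_le_exp (d ^ 2)⁻¹
        have : 0 < (d ^ 2)⁻¹ := by positivity
        nlinarith
    _ = (|d| * Real.exp (d ^ 2)⁻¹) ^ 2 := by rw [mul_pow, sq_abs]

lemma IsSeparatedBy.exists_prod_norm_add_I_sub_le {ι : Type*} {l : ℝ} {x : ι → ℝ}
    (hx : IsSeparatedBy l x) : ∃ E, ∀ (k : ι) (s : Finset ι) (t : ℝ), k ∉ s →
      ∏ j ∈ s, ‖x k + Complex.I - x j‖ ≤ E * ∏ j ∈ s, ‖x k + t * Complex.I - x j‖ := by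
  have hpos := hx.pos
  refine ⟨Real.exp ((1 + l⁻¹) ^ 2 * (4 * (2 + l⁻¹) ^ 2 * (1 + Real.log 2))),
    fun k s t hk => ?_⟩
  have hinv : ∀ j ∈ s, ((x k - x j) ^ 2)⁻¹ ≤
      (1 + l⁻¹) ^ 2 * ((1 + ‖(x k : ℂ) - x j‖) ^ 2)⁻¹ := fun j hj => by
    have hsep : l ≤ |x k - x j| := hx.le_abs_sub (ne_of_mem_of_not_mem hj hk).symm
    have hd : 0 < |x k - x j| := hpos.trans_le hsep
    have hle : 1 + |x k - x j| ≤ (1 + l⁻¹) * |x k - x j| := by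
      have : 1 ≤ l⁻¹ * |x k - x j| := by rwa [inv_mul_eq_div, one_le_div hpos]
      linarith
    rw [← Complex.ofReal_sub, Complex.norm_real, Real.norm_eq_abs, ← div_eq_mul_inv,
      ← sq_abs (x k - x j), inv_eq_one_div, div_le_div_iff₀ (by positivity) (by positivity),
      one_mul, ← mul_pow]
    gcongr
  have hfactor : ∀ j ∈ s, ‖x k + Complex.I - x j‖ ≤
      Real.exp ((x k - x j) ^ 2)⁻¹ * ‖x k + t * Complex.I - x j‖ := fun j hj => by
    have hd : x k - x j ≠ 0 := sub_ne_zero.2 (hx.injective.ne (ne_of_mem_of_not_mem hj hk).symm)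
    have hre : |x k - x j| ≤ ‖x k + t * Complex.I - x j‖ := by
      simpa using Complex.abs_re_le_norm (x k + t * Complex.I - x j)
    rw [add_sub_right_comm, ← Complex.ofReal_sub, mul_comm (Real.exp _)]
    exact (norm_ofReal_add_I_le hd).trans (by gcongr)
  calc ∏ j ∈ s, ‖x k + Complex.I - x j‖
      ≤ Real.exp (∑ j ∈ s, ((x k - x j) ^ 2)⁻¹) * ∏ j ∈ s, ‖x k + t * Complex.I - x j‖ := by
        rw [Real.exp_sum, ← Finset.prod_mul_distrib]
        exact Finset.prod_le_prod (fun _ _ => norm_nonneg _) hfactor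
    _ ≤ _ := by
        gcongr
        refine (Finset.sum_le_sum hinv).trans ?_
        rw [← Finset.mul_sum]
        gcongr
        exact hx.sum_inv_one_add_norm_sub_sq_le (x k) s

section GeneratingFunction

variable {x : ℤ → ℝ} {S : ℂ → ℂ} {b l r : ℝ} (hx : IsSeparatedBy l x)
include hx

lemma prod_filter_eq_zero_sub (hr : 0 < r) (z : ℂ) [Decidable (∃ k, x k = 0)] :
    ∏ j ∈ (hx.finite_abs_lt r).toFinset with x j = 0, (z - x j) =
      z ^ (if ∃ k, x k = 0 then 1 else 0 : ℕ) := by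
  split_ifs with h
  · obtain ⟨k, hk⟩ := h
    have hfilter : {j ∈ (hx.finite_abs_lt r).toFinset | x j = 0} = {k} := by
      ext j
      simp only [Finset.mem_filter, Set.Finite.mem_toFinset, Set.mem_ofPred_eq,
        Finset.mem_singleton]
      refine ⟨fun hj => hx.injective (hj.2.trans hk.symm), ?_⟩
      rintro rfl
      exact ⟨by rwa [hk, abs_zero], hk⟩
    rw [hfilter, Finset.prod_singleton, hk, Complex.ofReal_zero, sub_zero, pow_one]
  · rw [pow_zero, Finset.filter_false_of_mem fun j _ hj => h ⟨j, hj⟩, Finset.prod_empty]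

lemma exists_genPartialProd_eq (hr : 0 < r) :
    ∃ c : ℂ, ∀ z, genPartialProd x r z =
      c * ∏ j ∈ (hx.finite_abs_lt r).toFinset, (z - x j) := by
  classical
  set N := (hx.finite_abs_lt r).toFinset with hN
  refine ⟨∏ j ∈ N with x j ≠ 0, (-(x j : ℂ)⁻¹), fun z => ?_⟩
  have hset : {k : ℤ | 0 < |x k| ∧ |x k| < r} = ↑({j ∈ N | x j ≠ 0} : Finset ℤ) := by
    ext k
    simp [hN, and_comm]
  have hfactor : ∏ j ∈ N with x j ≠ 0, (1 - z / x j) =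
      (∏ j ∈ N with x j ≠ 0, (-(x j : ℂ)⁻¹)) * ∏ j ∈ N with x j ≠ 0, (z - x j) := by
    rw [← Finset.prod_mul_distrib]
    refine Finset.prod_congr rfl fun j hj => ?_
    have hj₀ : (x j : ℂ) ≠ 0 := Complex.ofReal_ne_zero.2 (Finset.mem_filter.1 hj).2
    field_simp
    ring
  rw [genPartialProd, hset, finprod_mem_coe_finset, hfactor, ← prod_filter_eq_zero_sub hx hr,
    ← Finset.prod_filter_mul_prod_filter_not N (fun j => x j = 0)]
  ring

lemma exists_norm_genPartialProd_le : ∃ E, ∀ (k : ℤ) (r t : ℝ), |x k| < r →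
    |t| * ‖genPartialProd x r (x k + Complex.I)‖ ≤
      E * ‖genPartialProd x r (x k + t * Complex.I)‖ := by
  obtain ⟨E, hE⟩ := hx.exists_prod_norm_add_I_sub_le
  refine ⟨E, fun k r t hr => ?_⟩
  obtain ⟨c, hc⟩ := exists_genPartialProd_eq hx ((abs_nonneg _).trans_lt hr)
  have hk : k ∈ (hx.finite_abs_lt r).toFinset := (hx.finite_abs_lt r).mem_toFinset.2 hr
  have hsplit (z : ℂ) : ‖genPartialProd x r z‖ =
      ‖c‖ * (‖z - x k‖ * ∏ j ∈ (hx.finite_abs_lt r).toFinset.erase k, ‖z - x j‖) := by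
    rw [hc, norm_mul, ← Finset.mul_prod_erase _ _ hk, norm_mul, norm_prod]
  have hprod := hE k _ t (Finset.notMem_erase k (hx.finite_abs_lt r).toFinset)
  rw [hsplit, hsplit, add_sub_cancel_left, add_sub_cancel_left, norm_mul, Complex.norm_I, one_mul,
    Complex.norm_real, Real.norm_eq_abs, mul_one]
  linear_combination |t| * ‖c‖ * hprod

lemma IsGeneratingFunction.apply_eq_zero (hS : IsGeneratingFunction x S) (k : ℤ) :
    S (x k) = 0 := by
  refine tendsto_nhds_unique (hS (x k)) (tendsto_const_nhds.congr' ?_)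
  filter_upwards [eventually_gt_atTop |x k|] with r hr
  obtain ⟨c, hc⟩ := exists_genPartialProd_eq hx ((abs_nonneg _).trans_lt hr)
  rw [hc, Finset.prod_eq_zero ((hx.finite_abs_lt r).mem_toFinset.2 hr) (sub_self (x k : ℂ)),
    mul_zero]

/-- The partial products converge only pointwise, so their derivatives are not available; instead
the lower bound for the partial products at `x k + t * I` is uniform as `t → 0`. -/
lemma IsGeneratingFunction.deriv_ne_zero (hS : IsGeneratingFunction x S)
    (hdiff : Differentiable ℂ S) {k : ℤ} (hk : S (x k + Complex.I) ≠ 0) : deriv S (x k) ≠ 0 := by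
  obtain ⟨E, hE⟩ := exists_norm_genPartialProd_le hx
  have hlim (t : ℝ) : |t| * ‖S (x k + Complex.I)‖ ≤ E * ‖S (x k + t * Complex.I)‖ :=
    le_of_tendsto_of_tendsto ((hS _).norm.const_mul _) ((hS _).norm.const_mul _)
      ((eventually_gt_atTop |x k|).mono fun r hr => hE k r t hr)
  have hdslope {t : ℝ} (ht : t ≠ 0) :
      ‖S (x k + Complex.I)‖ ≤ E * ‖dslope S (x k) (x k + t * Complex.I)‖ := by
    have hmul := hlim t
    rw [← sub_mul_dslope (hS.apply_eq_zero hx k) (x k + t * Complex.I), add_sub_cancel_left,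
      norm_mul, norm_mul, Complex.norm_I, mul_one, Complex.norm_real, Real.norm_eq_abs,
      mul_left_comm] at hmul
    exact le_of_mul_le_mul_left hmul (abs_pos.2 ht)
  have hcont : Continuous fun t : ℝ => E * ‖dslope S (x k) (x k + t * Complex.I)‖ :=
    continuous_const.mul ((differentiable_dslope hdiff _).continuous.comp (by fun_prop)).norm
  have hzero : ‖S (x k + Complex.I)‖ ≤ E * ‖deriv S (x k)‖ := by
    have h := ge_of_tendsto (hcont.continuousAt.continuousWithinAt (x := 0) (s := {0}ᶜ)).tendsto
      (eventually_nhdsWithin_of_forall fun t ht => hdslope ht)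
    simpa using h
  intro h₀
  rw [h₀, norm_zero, mul_zero, norm_le_zero_iff] at hzero
  exact hk hzero

end GeneratingFunction

lemma lt_infDist_pointSet {x : ℤ → ℝ} {z : ℂ} {ε δ : ℝ} (hδ : δ < ε)
    (hz : ∀ k, ε ≤ ‖z - x k‖) : δ < Metric.infDist z (pointSet x) :=
  hδ.trans_le ((Metric.le_infDist (Set.range_nonempty _)).2 <| by
    rintro _ ⟨k, rfl⟩
    exact (hz k).trans_eq (dist_eq_norm _ _).symm)

lemma IsSineTypeGenerating.isSineType {x : ℤ → ℝ} {S : ℂ → ℂ} {b l : ℝ}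
    (hx : IsSeparatedBy l x) (hS : IsSineTypeGenerating x S b) : IsSineType x S b := by
  have hlower (ε : ℝ) (hε : 0 < ε) : ∃ c > 0, ∀ z : ℂ, (∀ k, ε ≤ ‖z - x k‖) →
      c * Real.exp (Real.pi * b * |z.im|) ≤ ‖S z‖ := by
    obtain ⟨c, _, hc, -, hcS⟩ := hS.bounds (ε / 2) (half_pos hε)
    refine ⟨c, hc, fun z hz => ?_⟩
    have h := (hcS z (lt_infDist_pointSet (half_lt_self hε) hz)).1
    rwa [Real.exp_neg, inv_mul_eq_div, le_div_iff₀ (Real.exp_pos _)] at h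
  have hupper (ε : ℝ) (hε : 0 < ε) : ∃ C, ∀ z : ℂ, (∀ k, ε ≤ ‖z - x k‖) →
      ‖S z‖ ≤ C * Real.exp (Real.pi * b * |z.im|) := by
    obtain ⟨_, C, -, -, hCS⟩ := hS.bounds (ε / 2) (half_pos hε)
    refine ⟨C, fun z hz => ?_⟩
    have h := (hCS z (lt_infDist_pointSet (half_lt_self hε) hz)).2
    rwa [Real.exp_neg, inv_mul_eq_div, div_le_iff₀ (Real.exp_pos _)] at h
  refine ⟨hS.type_eq.1, hS.generating.apply_eq_zero hx, fun k => ?_, hlower, hupper⟩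
  obtain ⟨c, hc, hcS⟩ := hlower 1 one_pos
  have hfar (j : ℤ) : 1 ≤ ‖(x k + Complex.I : ℂ) - x j‖ := by
    simpa using Complex.abs_im_le_norm ((x k + Complex.I : ℂ) - x j)
  have hpos : 0 < ‖S (x k + Complex.I)‖ := lt_of_lt_of_le (by positivity) (hcS _ hfar)
  exact hS.generating.deriv_ne_zero hx hS.type_eq.1 (norm_pos_iff.1 hpos)

theorem mainTheorem2_general (x : ℤ → ℝ) {l : ℝ} (hx : IsSeparatedBy l x) (S : ℂ → ℂ) (b : ℝ)
    (hS : IsSineType x S b) (xt : ℂ) (hxt : xt ∉ pointSet x) :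
    (∀ f ∈ PWPlus b, ∀ K : Set ℂ, IsCompact K →
      TendstoUniformlyOn
        (fun (r : ℝ) (z : ℂ) =>
          interpPartialSum x S xt (f xt) (fun k => f (x k : ℂ)) {k : ℤ | |x k| < r} z)
        f atTop K) ∧
    (∃ C : ℝ, ∀ (ta : ℂ) (a : lp (fun _ : ℤ => ℂ) ⊤), ∃ f ∈ PWPlus b,
      (∀ K : Set ℂ, IsCompact K →
        TendstoUniformlyOn
          (fun (s : Finset ℤ) (z : ℂ) => interpPartialSum x S xt ta (⇑a) (↑s : Set ℤ) z)
          f atTop K) ∧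
      f xt = ta ∧ (∀ k : ℤ, f (x k : ℂ) = a k) ∧
      ∀ z : ℂ, ‖f z‖ ≤
        C * max ‖a‖ ‖ta‖ * Real.exp (Real.pi * b * |z.im|) * (1 + max (Real.log ‖z‖) 0)) := by
  refine ⟨fun f hf K hK => hS.tendstoUniformlyOn_interpPartialSum hx hxt hf.1 hf.2 hK, ?_⟩
  obtain ⟨C, hC⟩ := hS.exists_norm_interpolant_le hx hxt
  refine ⟨C, fun ta a => ⟨interpolant x S xt ta a, ?_⟩⟩
  have ha (k : ℤ) : ‖a k‖ ≤ max ‖a‖ ‖ta‖ :=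
    (lp.norm_apply_le_norm ENNReal.top_ne_zero a k).trans (le_max_left _ _)
  have hgrowth := hC ta a _ ha (le_max_right _ _)
  exact ⟨mem_PWPlus_of_norm_le (hS.differentiable_interpolant hx hxt ha) hgrowth,
    fun K hK => hS.tendstoUniformlyOn_interpolant hx hxt ha hK, hS.interpolant_apply_xt hx hxt,
    hS.interpolant_apply_node hx hxt, hgrowth⟩

theorem mainTheorem2 (x : ℤ → ℝ) (hx : IsSeparatedSeq x) (S : ℂ → ℂ) (b : ℝ)
    (hS : IsSineTypeGenerating x S b) (xt : ℂ) (hxt : xt ∉ pointSet x) :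
    (∀ f ∈ PWPlus b, ∀ K : Set ℂ, IsCompact K →
      TendstoUniformlyOn
        (fun (r : ℝ) (z : ℂ) =>
          interpPartialSum x S xt (f xt) (fun k => f (x k : ℂ)) {k : ℤ | |x k| < r} z)
        f atTop K) ∧
    (∃ C : ℝ, ∀ (ta : ℂ) (a : lp (fun _ : ℤ => ℂ) ⊤), ∃ f ∈ PWPlus b,
      (∀ K : Set ℂ, IsCompact K →
        TendstoUniformlyOn
          (fun (s : Finset ℤ) (z : ℂ) => interpPartialSum x S xt ta (⇑a) (↑s : Set ℤ) z)
          f atTop K) ∧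
      f xt = ta ∧ (∀ k : ℤ, f (x k : ℂ) = a k) ∧
      ∀ z : ℂ, ‖f z‖ ≤
        C * max ‖a‖ ‖ta‖ * Real.exp (Real.pi * b * |z.im|) * (1 + max (Real.log ‖z‖) 0)) :=
  mainTheorem2_general x hx.isSeparatedBy S b (hS.isSineType hx.isSeparatedBy) xt hxt
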